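/- Let $m\ge 1$ and $n\ge 0$ be integers, $a_1,\dots,a_m\in\mathbb R^n$, $y_1,\dots,y_m\in\{1,-1\}$, $\mu>0$, and let $$f(x)=f_{svm}(x)=\frac1{2m}\sum_{i=1}^m\max\{1-y_i\langle a_i,x\rangle,0\}^2+\frac\mu2\|x\|^2 ,\qquad x\in\mathbb R^n .$$ Let $q\in[0,1)$, $\lambda>0$ and $F(x)=f(x)+\lambda\|x\|_q^q$, where $\|x\|_q^q=\sum_{i:\,x_i\ne 0}|x_i|^q$ (the number of nonzero entries if $q=0$). *Notation.* $\mathrm{supp}(x)=\{i:x_i\neq0\}$, and $E(x;T)=f(x)+\lambda\sum_{i\in T,\,x_i\neq 0}|x_i|^q$. For a function $g$ that is continuously differentiable with Lipschitz gradient near $x$, $\partial^2g(x)$ is the convex hull of all limits of $\nabla^2g(z^i)$ along sequences $z^i\to x$ of points at which $g$ is twice differentiable. For $S=\mathrm{supp}(x)$ let $\nabla_SE(x)=(\nabla E(x;S))_S$, and let $\partial^2_SE(x)$ be the set of the principal submatrices $H_S$, $H\in\partial^2E(x;S)$ (the Hessian set of $E(\cdot;S)$ at $x$). $\mathrm{Prox}_r(u)$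 is the set of minimizers of $w\mapsto\frac12\|u-w\|^2+r(w)$. *Algorithm (PSNP).* Let $x^0\in\mathbb R^n$, $\sigma>0$, $\tau>0$, $\gamma\in(0,1)$. Put $$c_0=\sup_{F(x)\le F(x^0)}5\big(\|x\|^2+\tau^2\|\nabla f(x)\|^2+\tau\lambda\|x\|_q^q\big),\qquad \sigma_0=\sup\{\|H\|: H\in\partial^2f(x),\ \|x\|^2<c_0\}$$ (with $\|H\|$ the spectral norm, and $\sigma_0=0$ if no $x$ satisfies $\|x\|^2<c_0$), and fix a step size $0<\alpha\le\min\{\tau,1/(\sigma+\sigma_0)\}$. For $k=0,1,2,\dots$: 1. choose $w^k\in\mathrm{Prox}_{\alpha\lambda\|\cdot\|_q^q}(x^k-\alpha\nabla f(x^k))$; 2. put $S^k=\mathrm{supp}(w^k)$ and choose $M^k\in\partial^2_{S^k}E(w^k)$; 3. if the equations $M^kd_{S^k}=\nabla_{S^k}E(w^k)$, $d_i=0$ for $i\notin S^k$, are solvable, choose a solution $d^k$; if moreover there is an integer $s\ge0$ with $F(w^k-\gamma^{s}d^k)\le F(w^k)-\frac\sigma2\|\gamma^{s}d^k\|^2$,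 put $x^{k+1}=w^k-\gamma^{s_k}d^k$ for the smallest such integer $s_k$. In all other cases put $x^{k+1}=w^k$. **Statement.** Let $(x^k),(w^k)$ be any sequences generated by PSNP, and let $x^*$ be an accumulation point of $(x^k)$ (for instance its limit), with $S^*=\mathrm{supp}(x^*)$. Suppose that the second-order sufficient condition holds at $x^*$, $$\langle Mv,v\rangle>0\qquad\text{for all }M\in\partial^2_{S^*}E(x^*)\text{ and all }0\ne v\in\mathbb R^{|S^*|},$$ and that $\sigma\in(0,\sigma_*)$, where $\sigma_*=\frac12\inf\{\langle Mv,v\rangle: M\in\partial^2_{S^*}E(x^*),\ \|v\|=1\}$ ($\sigma_*=+\infty$ if $S^*=\emptyset$). Then: - every proximal step has sufficient decrease, $F(w^k)\le F(x^k)-\frac\sigma2\|w^k-x^k\|^2$ for all $k$; - the whole sequence $(x^k)$ converges to $x^*$, and quadratically: there is $C>0$ with $\|x^{k+1}-x^*\|\le C\|x^k-x^*\|^2$ for all sufficiently large $k$; - $x^*$ is a unique local minimizer of $F$: there are $\eta>0$ and a neighbourhood of $x^*$ on which $F(x)\ge F(x^*)+\eta\|x-x^*\|^2$, and $x^*$ is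 the only local minimizer of $F$ in some neighbourhood of $x^*$. -/

import Mathlib

open Filter Topology

namespace PSNP

noncomputable section

/-- `ℝⁿ` with its Euclidean norm. -/
abbrev Vec (n : ℕ) : Type := EuclideanSpace ℝ (Fin n)

/-- The squared-hinge soft-margin SVM objective
`(1/(2m)) ∑ᵢ max{1 - yᵢ⟨aᵢ, x⟩, 0}² + (μ/2)‖x‖²`. -/
def fsvm {n m : ℕ} (a : Fin m → Vec n) (y : Fin m → ℝ) (μ : ℝ) (x : Vec n) : ℝ :=
  1 / (2 * (m : ℝ)) * ∑ i, (max (1 - y i * inner ℝ (a i) x) 0) ^ 2 + μ / 2 * ‖x‖ ^ 2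

/-- The support of a vector. -/
def supp {n : ℕ} (x : Vec n) : Finset (Fin n) := Finset.univ.filter fun i => x i ≠ 0

/-- `|t|^q` with the convention `0^q = 0`, also for `q = 0`. -/
def absPow (q t : ℝ) : ℝ := if t = 0 then 0 else |t| ^ q

/-- `‖x_T‖_q^q`, the `L_q` penalty of the subvector indexed by `T`. -/
def lqOn {n : ℕ} (q : ℝ) (T : Finset (Fin n)) (x : Vec n) : ℝ := ∑ i ∈ T, absPow q (x i)

/-- `‖x‖_q^q`; for `q = 0` this is the number of nonzero entries. -/
def lq {n : ℕ} (q : ℝ) (x : Vec n) : ℝ := lqOn q Finset.univ x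

/-- The regularized objective `F = f + lam ‖·‖_q^q`. -/
def objF {n : ℕ} (f : Vec n → ℝ) (q lam : ℝ) (x : Vec n) : ℝ := f x + lam * lq q x

/-- `E(·; T) = f + lam ‖(·)_T‖_q^q`. -/
def objE {n : ℕ} (f : Vec n → ℝ) (q lam : ℝ) (T : Finset (Fin n)) (x : Vec n) : ℝ :=
  f x + lam * lqOn q T x

/-- The proximal operator of `r`: the set of minimizers of `½‖u - ·‖² + r`. -/
def prox {n : ℕ} (r : Vec n → ℝ) (u : Vec n) : Set (Vec n) :=
  {w | ∀ z, 1 / 2 * ‖u - w‖ ^ 2 + r w ≤ 1 / 2 * ‖u - z‖ ^ 2 + r z}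

/-- `g` is twice differentiable at `x`. -/
def TwiceDiffAt {n : ℕ} (g : Vec n → ℝ) (x : Vec n) : Prop :=
  (∀ᶠ z in 𝓝 x, DifferentiableAt ℝ g z) ∧ DifferentiableAt ℝ (gradient g) x

/-- The Hessian matrix of `g` at `x`: the matrix of the derivative of the gradient. -/
def hessian {n : ℕ} (g : Vec n → ℝ) (x : Vec n) : Matrix (Fin n) (Fin n) ℝ :=
  (Matrix.toEuclideanCLM (n := Fin n) (𝕜 := ℝ)).symm (fderiv ℝ (gradient g) x)

/-- The generalized Hessian `∂²g(x)`: the convex hull of all limits of Hessian matrices of `g`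
along sequences of points of twice differentiability converging to `x`. -/
def genHessian {n : ℕ} (g : Vec n → ℝ) (x : Vec n) : Set (Matrix (Fin n) (Fin n) ℝ) :=
  convexHull ℝ {H | ∃ z : ℕ → Vec n, Tendsto z atTop (𝓝 x) ∧ (∀ i, TwiceDiffAt g (z i)) ∧
    Tendsto (fun i => hessian g (z i)) atTop (𝓝 H)}

/-- The principal submatrix with rows and columns indexed by `S`. -/
def principal {n : ℕ} (S : Finset (Fin n)) (H : Matrix (Fin n) (Fin n) ℝ) : Matrix S S ℝ :=
  H.submatrix (fun i => (i : Fin n)) (fun i => (i : Fin n))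

/-- `∂²_S E(x) = {H_S : H ∈ ∂²E(x; S)}`. -/
def genHessianE {n : ℕ} (f : Vec n → ℝ) (q lam : ℝ) (S : Finset (Fin n)) (x : Vec n) :
    Set (Matrix S S ℝ) :=
  principal S '' genHessian (objE f q lam S) x

/-- The second-order sufficient condition at `x`: with `S = supp x`, every matrix in
`∂²_S E(x)` has a positive quadratic form. -/
def SecondOrderSufficient {n : ℕ} (f : Vec n → ℝ) (q lam : ℝ) (x : Vec n) : Prop :=
  ∀ M ∈ genHessianE f q lam (supp x) x, ∀ v : supp x → ℝ, v ≠ 0 → 0 < M.mulVec v ⬝ᵥ v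

/-- `σ_* = ½ inf {⟨Mv, v⟩ : M ∈ ∂²_S E(x), ‖v‖ = 1}` with `S = supp x`, as an extended real
number (`+∞` if `S` is empty). -/
def sigmaStar {n : ℕ} (f : Vec n → ℝ) (q lam : ℝ) (x : Vec n) : EReal :=
  sInf {r : EReal | ∃ M ∈ genHessianE f q lam (supp x) x, ∃ v : EuclideanSpace ℝ (supp x),
    ‖v‖ = 1 ∧ r = ((1 / 2 * (M.mulVec (fun i => v i) ⬝ᵥ fun i => v i) : ℝ) : EReal)}

/-- `c₀ = sup {5(‖x‖² + τ²‖∇f(x)‖² + τ lam ‖x‖_q^q) : F(x) ≤ F(x⁰)}`. -/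
def c0 {n : ℕ} (f : Vec n → ℝ) (q lam τ : ℝ) (x0 : Vec n) : ℝ :=
  sSup {r | ∃ x, objF f q lam x ≤ objF f q lam x0 ∧
    r = 5 * (‖x‖ ^ 2 + τ ^ 2 * ‖gradient f x‖ ^ 2 + τ * lam * lq q x)}

/-- `σ₀ = sup {‖H‖ : H ∈ ∂²f(x), ‖x‖² < c₀}`, with the spectral norm of matrices. -/
def sigma0 {n : ℕ} (f : Vec n → ℝ) (q lam τ : ℝ) (x0 : Vec n) : ℝ :=
  sSup {r | ∃ x, ‖x‖ ^ 2 < c0 f q lam τ x0 ∧ ∃ H ∈ genHessian f x,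
    r = ‖Matrix.toEuclideanCLM (n := Fin n) (𝕜 := ℝ) H‖}

/-- `d` solves the Newton equations at `w`: `M d_S = ∇_S E(w; S)` and `d` vanishes outside `S`,
where `S = supp w`. -/
def IsNewtonDir {n : ℕ} (f : Vec n → ℝ) (q lam : ℝ) (w : Vec n)
    (M : Matrix (supp w) (supp w) ℝ) (d : Vec n) : Prop :=
  (M.mulVec (fun i => d i) = fun i : supp w => gradient (objE f q lam (supp w)) w i) ∧
    ∀ i, i ∉ supp w → d i = 0

/-- The exponent `s` passes the line search test
`F(w - γ^s d) ≤ F(w) - (σ/2)‖γ^s d‖²`. -/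
def Admissible {n : ℕ} (f : Vec n → ℝ) (q lam σ γ : ℝ) (w d : Vec n) (s : ℕ) : Prop :=
  objF f q lam (w - γ ^ s • d) ≤ objF f q lam w - σ / 2 * ‖γ ^ s • d‖ ^ 2

/-- The Newton phase of PSNP, leading from `w` to the next iterate `x'`. A matrix
`M ∈ ∂²_S E(w)`, `S = supp w`, is chosen. If the Newton equations are solvable, a solution `d` is
chosen, and if some exponent passes the line search test, then `x' = w - γ^s d` for the smallest
such exponent `s`. In all other cases `x' = w`. -/
def NewtonPhase {n : ℕ} (f : Vec n → ℝ) (q lam σ γ : ℝ) (w x' : Vec n) : Prop :=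
  ∃ M ∈ genHessianE f q lam (supp w) w,
    (∃ d, IsNewtonDir f q lam w M d ∧
      ∃ s, IsLeast {s : ℕ | Admissible f q lam σ γ w d s} s ∧ x' = w - γ ^ s • d) ∨
    (∃ d, IsNewtonDir f q lam w M d ∧ (∀ s, ¬ Admissible f q lam σ γ w d s) ∧ x' = w) ∨
    ((¬ ∃ d, IsNewtonDir f q lam w M d) ∧ x' = w)

/-- `(x, w)` are the iterates of PSNP with constant proximal step size `α`:
`wᵏ ∈ Prox_{α lam ‖·‖_q^q}(xᵏ - α ∇f(xᵏ))`, and `xᵏ⁺¹` comes from `wᵏ` by the Newton phase. -/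
def IsPSNPRun {n : ℕ} (f : Vec n → ℝ) (q lam σ γ α : ℝ) (x w : ℕ → Vec n) : Prop :=
  ∀ k, w k ∈ prox (fun z => α * lam * lq q z) (x k - α • gradient f (x k)) ∧
    NewtonPhase f q lam σ γ (w k) (x (k + 1))

/-- The sufficient decrease test of the proximal phase,
`F(wᵏ) ≤ F(xᵏ) - (σ/2)‖wᵏ - xᵏ‖²` for all `k`. -/
def SufficientDecrease {n : ℕ} (f : Vec n → ℝ) (q lam σ : ℝ) (x w : ℕ → Vec n) : Prop :=
  ∀ k, objF f q lam (w k) ≤ objF f q lam (x k) - σ / 2 * ‖w k - x k‖ ^ 2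

/-- `p` is a locally unique minimizer of `F`: `F` grows at least quadratically around `p`, and no
other point near `p` is a local minimizer. -/
def IsUniqueLocalMin {n : ℕ} (F : Vec n → ℝ) (p : Vec n) : Prop :=
  (∃ η > 0, ∀ᶠ z in 𝓝 p, F p + η * ‖z - p‖ ^ 2 ≤ F z) ∧ ∀ᶠ z in 𝓝 p, IsLocalMin F z → z = p

/-- `x` converges to `p` with quadratic rate. -/
def ConvergesQuadratically {n : ℕ} (x : ℕ → Vec n) (p : Vec n) : Prop :=
  Tendsto x atTop (𝓝 p) ∧ ∃ C > 0, ∀ᶠ k in atTop, ‖x (k + 1) - p‖ ≤ C * ‖x k - p‖ ^ 2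

end

end PSNP

/-! ### Functions with piecewise affine gradient and their generalized Hessians -/

namespace PSNP

/-! The gradient of the squared-hinge objective is affine on each of finitely many closed convex
cells, and the penalty on a fixed support is smooth. The generalized Hessian of `f + p` at `z` is
therefore the convex hull of the operators `A I + D∇p(z)` over the full-dimensional cells through
`z` (`mem_genHessian`, `toEuclideanCLM_mem_convexHull`), and bounds on these operators integrate
along segments (`quadratic_lower`, `quadratic_upper`).

Globally, `c0` is large enough that proximal segments starting in the initial level set stay where
`sigma0` bounds the Hessians, so the descent lemma gives sufficient decrease (`sufficientDecrease`)
and all steps tend to zero. Since `q < 1`, nonzero entries of proximal points are bounded away from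
zero; hence every `w k` near `xs` has the support `S` of `xs`, and `xs` is a fixed point of the
proximal map, so the gradient of `E(·; S)` vanishes on `S` at `xs`.

Locally, `σ < σ_*` makes the forms at `xs` at least `2σ` on vectors supported in `S`. Cells through
a point near `xs` also contain `xs`, so the linearization of `∇f` between the two points is exact
and only the smooth penalty contributes an error, which is quadratic. Newton's method from `w` thus
has error `O(‖w - xs‖²)`, and its full step passes the line search (`exists_newtonPhase_bound`).
Decrease together with local convexity gives `‖w - xs‖ = O(‖x - xs‖)` for the proximal step
(`norm_prox_sub_sq_le`). One visit close enough to `xs` then traps the sequence, so an accumulation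
point suffices for convergence of the whole sequence.

For growth of `F` at `xs`, convexity handles the coordinates in `S`, and the penalty beats every
linear term off `S`. Isolation among local minimizers combines stationarity with monotonicity of the
gradient. -/

/-- `f` is differentiable, and the closed convex cells `P I` cover the space and carry affine
restrictions of the gradient of `f`, with linear parts `A I`. -/
structure PiecewiseAffineGradient {n : ℕ} {ι : Type*} (f : Vec n → ℝ) (P : ι → Set (Vec n))
    (A : ι → Vec n →L[ℝ] Vec n) : Prop where
  differentiable : Differentiable ℝ f
  isClosed : ∀ I, IsClosed (P I)
  convex : ∀ I, Convex ℝ (P I)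
  cover : ∀ z, ∃ I, z ∈ P I
  gradient_sub : ∀ I, ∀ z ∈ P I, ∀ z' ∈ P I, gradient f z - gradient f z' = A I (z - z')

theorem gradient_add' {n : ℕ} {f p : Vec n → ℝ} {z : Vec n} (hf : DifferentiableAt ℝ f z)
    (hp : DifferentiableAt ℝ p z) :
    gradient (fun x => f x + p x) z = gradient f z + gradient p z := by
  simp only [gradient]
  rw [fderiv_fun_add hf hp, map_add]

theorem gradient_zero_fun {n : ℕ} : gradient (fun _ : Vec n => (0 : ℝ)) = fun _ => 0 :=
  funext fun x => gradient_fun_const x 0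

theorem gradient_apply {n : ℕ} (p : Vec n → ℝ) (z : Vec n) (i : Fin n) :
    gradient p z i = fderiv ℝ p z (EuclideanSpace.single i 1) := by
  rw [← inner_gradient_left, EuclideanSpace.inner_single_right]
  simp

theorem contDiffAt_gradient {n : ℕ} {p : Vec n → ℝ} {z : Vec n} (hp : ContDiffAt ℝ 3 p z) :
    ContDiffAt ℝ 2 (gradient p) z := by
  rw [contDiffAt_euclidean]
  intro i
  have h : ContDiffAt ℝ 2 (fderiv ℝ p) z := hp.fderiv_right (by norm_num)
  have h2 := h.clm_apply (contDiffAt_const (c := EuclideanSpace.single i (1 : ℝ)))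
  refine h2.congr_of_eventuallyEq (Eventually.of_forall fun x => ?_)
  exact gradient_apply p x i

theorem contDiffAt_fderiv_gradient {n : ℕ} {p : Vec n → ℝ} {z : Vec n}
    (hp : ContDiffAt ℝ 3 p z) : ContDiffAt ℝ 1 (fderiv ℝ (gradient p)) z :=
  (contDiffAt_gradient hp).fderiv_right (by norm_num)

theorem eventually_contDiffAt {n : ℕ} {p : Vec n → ℝ} {z : Vec n} (hp : ContDiffAt ℝ 3 p z) :
    ∀ᶠ x in 𝓝 z, ContDiffAt ℝ 3 p x :=
  hp.eventually (by simp)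

namespace PiecewiseAffineGradient

variable {n : ℕ} {ι : Type*} {f : Vec n → ℝ} {P : ι → Set (Vec n)} {A : ι → Vec n →L[ℝ] Vec n}

theorem neg (h : PiecewiseAffineGradient f P A) :
    PiecewiseAffineGradient (fun x => -f x) P (fun I => -A I) where
  differentiable := h.differentiable.fun_neg
  isClosed := h.isClosed
  convex := h.convex
  cover := h.cover
  gradient_sub I z hz z' hz' := by
    have key : ∀ x, gradient (fun x => -f x) x = - gradient f x := by
      intro x
      simp only [gradient]
      rw [fderiv_fun_neg, map_neg]
    rw [key, key, neg_apply, ← h.gradient_sub I z hz z' hz']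
    abel

/-- By Baire the interiors of the cells have dense union, and the closure of a finite union is the
union of the closures. Only cells with interior determine the derivative of the gradient. -/
theorem exists_full_mem [Finite ι] (h : PiecewiseAffineGradient f P A) (z : Vec n) :
    ∃ I, (interior (P I)).Nonempty ∧ z ∈ P I := by
  have hd := dense_iUnion_interior_of_closed h.isClosed
    (Set.eq_univ_of_forall fun z => Set.mem_iUnion.2 (h.cover z))
  have hz := hd z
  rw [closure_iUnion_of_finite] at hz
  obtain ⟨I, hI⟩ := Set.mem_iUnion.1 hz
  exact ⟨I, closure_nonempty_iff.1 ⟨z, hI⟩,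
    (h.isClosed I).closure_subset_iff.2 interior_subset hI⟩

/-- The finitely many closed cells that miss `z` stay away from it. So a nearby point and `z` share
a cell, on which gradient differences are exactly linear. -/
theorem eventually_mem [Finite ι] (h : PiecewiseAffineGradient f P A) (z : Vec n) :
    ∀ᶠ x in 𝓝 z, ∀ I, x ∈ P I → z ∈ P I := by
  rw [eventually_all]
  intro I
  by_cases hz : z ∈ P I
  · exact Eventually.of_forall fun _ _ => hz
  · filter_upwards [(h.isClosed I).isOpen_compl.mem_nhds hz] with x hx hx'
    exact absurd hx' hx

theorem exists_norm_le [Finite ι] (A : ι → Vec n →L[ℝ] Vec n) :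
    ∃ L, 0 ≤ L ∧ ∀ I, ‖A I‖ ≤ L := by
  obtain ⟨L, hL⟩ := (Set.finite_range fun I => ‖A I‖).bddAbove
  exact ⟨max L 0, le_max_right _ _, fun I => (hL ⟨I, rfl⟩).trans (le_max_left _ _)⟩

theorem eventually_norm_gradient_sub_le [Finite ι] (h : PiecewiseAffineGradient f P A) {L : ℝ}
    (hL : ∀ I, ‖A I‖ ≤ L) (z : Vec n) :
    ∀ᶠ x in 𝓝 z, ‖gradient f x - gradient f z‖ ≤ L * ‖x - z‖ := by
  filter_upwards [h.eventually_mem z] with x hx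
  obtain ⟨I, hI⟩ := h.cover x
  rw [h.gradient_sub I x hI z (hx I hI)]
  exact ((A I).le_opNorm _).trans (mul_le_mul_of_nonneg_right (hL I) (norm_nonneg _))

theorem continuous_gradient [Finite ι] (h : PiecewiseAffineGradient f P A) :
    Continuous (gradient f) := by
  rw [continuous_iff_continuousAt]
  intro z
  obtain ⟨L, -, hL⟩ := exists_norm_le A
  rw [ContinuousAt, tendsto_iff_norm_sub_tendsto_zero]
  refine squeeze_zero' (Eventually.of_forall fun _ => norm_nonneg _)
    (h.eventually_norm_gradient_sub_le hL z) ?_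
  have : Continuous fun x => L * ‖x - z‖ := by fun_prop
  simpa using this.tendsto z

theorem hasFDerivWithinAt_gradient (h : PiecewiseAffineGradient f P A) {I : ι} {z : Vec n}
    (hz : z ∈ P I) : HasFDerivWithinAt (gradient f) (A I) (P I) z := by
  have : HasFDerivWithinAt (fun x => gradient f z + A I (x - z)) (A I) (P I) z := by
    have h1 := ((A I).hasFDerivAt (x := z)).sub_const (A I z) |>.const_add (gradient f z)
    simpa only [map_sub] using h1.hasFDerivWithinAt
  refine this.congr (fun x hx => ?_) ?_
  · simp only [← h.gradient_sub I x hx z hz]; abel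
  · simp

/-- A convex set with interior has unique derivatives even at its boundary points, so the
within-cell derivative is the full one as soon as the latter exists. -/
theorem fderiv_gradient_eq (h : PiecewiseAffineGradient f P A) {I : ι} {z : Vec n}
    (hI : (interior (P I)).Nonempty) (hz : z ∈ P I) (hd : DifferentiableAt ℝ (gradient f) z) :
    fderiv ℝ (gradient f) z = A I :=
  (uniqueDiffOn_convex (h.convex I) hI z hz).eq hd.hasFDerivAt.hasFDerivWithinAt
    (h.hasFDerivWithinAt_gradient hz)

theorem hasFDerivAt_gradient (h : PiecewiseAffineGradient f P A) {I : ι} {z : Vec n}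
    (hz : z ∈ interior (P I)) : HasFDerivAt (gradient f) (A I) z :=
  (h.hasFDerivWithinAt_gradient (interior_subset hz)).hasFDerivAt (mem_interior_iff_mem_nhds.1 hz)

variable {p : Vec n → ℝ}

theorem gradient_add_eventuallyEq (h : PiecewiseAffineGradient f P A) {z : Vec n}
    (hp : ContDiffAt ℝ 3 p z) :
    gradient (fun x => f x + p x) =ᶠ[𝓝 z] fun x => gradient f x + gradient p x := by
  filter_upwards [eventually_contDiffAt hp] with x hx
  exact gradient_add' h.differentiable.differentiableAt (hx.differentiableAt (by norm_num))

theorem twiceDiffAt_add (h : PiecewiseAffineGradient f P A) {z : Vec n}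
    (hp : ContDiffAt ℝ 3 p z) {I : ι} (hz : z ∈ interior (P I)) :
    TwiceDiffAt (fun x => f x + p x) z ∧
      hessian (fun x => f x + p x) z =
        (Matrix.toEuclideanCLM (n := Fin n) (𝕜 := ℝ)).symm (A I + fderiv ℝ (gradient p) z) := by
  have hp2 : DifferentiableAt ℝ (gradient p) z :=
    (contDiffAt_gradient hp).differentiableAt (by norm_num)
  have hd := ((h.hasFDerivAt_gradient hz).add hp2.hasFDerivAt).congr_of_eventuallyEq
    (h.gradient_add_eventuallyEq hp)
  refine ⟨⟨?_, hd.differentiableAt⟩, ?_⟩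
  · filter_upwards [eventually_contDiffAt hp] with x hx
    exact h.differentiable.differentiableAt.add (hx.differentiableAt (by norm_num))
  · rw [hessian, hd.fderiv]

theorem fderiv_gradient_add (h : PiecewiseAffineGradient f P A) {z : Vec n}
    (hp : ContDiffAt ℝ 3 p z) {I : ι} (hI : (interior (P I)).Nonempty) (hz : z ∈ P I)
    (hd : TwiceDiffAt (fun x => f x + p x) z) :
    fderiv ℝ (gradient fun x => f x + p x) z = A I + fderiv ℝ (gradient p) z := by
  have hp2 : DifferentiableAt ℝ (gradient p) z :=
    (contDiffAt_gradient hp).differentiableAt (by norm_num)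
  have heq := h.gradient_add_eventuallyEq hp
  have hdf : DifferentiableAt ℝ (gradient f) z := by
    refine (hd.2.sub hp2).congr_of_eventuallyEq ?_
    filter_upwards [heq] with x hx
    simp [hx]
  rw [heq.fderiv_eq, fderiv_fun_add hdf hp2, h.fderiv_gradient_eq hI hz hdf]

/-- A convex cell with interior lies in the closure of its interior. Approaching `z` from there, the
Hessians are `A I + D∇p`, and `D∇p` is continuous. -/
theorem mem_genHessian (h : PiecewiseAffineGradient f P A) {z : Vec n}
    (hp : ContDiffAt ℝ 3 p z) {I : ι} (hI : (interior (P I)).Nonempty) (hz : z ∈ P I) :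
    (Matrix.toEuclideanCLM (n := Fin n) (𝕜 := ℝ)).symm (A I + fderiv ℝ (gradient p) z) ∈
      genHessian (fun x => f x + p x) z := by
  refine subset_convexHull ℝ _ ?_
  have hcl : z ∈ closure (interior (P I)) := by
    rw [(h.convex I).closure_interior_eq_closure_of_nonempty_interior hI]
    exact subset_closure hz
  obtain ⟨u, hu, hlim⟩ := mem_closure_iff_seq_limit.1 hcl
  -- The definition asks for twice differentiability at every term, so the terms before `p` becomes
  -- smooth are dropped.
  obtain ⟨N, hN⟩ := eventually_atTop.1 (hlim.eventually (eventually_contDiffAt hp))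
  have hlim' : Tendsto (fun i => u (i + N)) atTop (𝓝 z) := hlim.comp (tendsto_add_atTop_nat N)
  refine ⟨fun i => u (i + N), hlim', fun i =>
    (h.twiceDiffAt_add (hN _ (Nat.le_add_left _ _)) (hu _)).1, ?_⟩
  have hc : ContinuousAt (fun x => (Matrix.toEuclideanCLM (n := Fin n) (𝕜 := ℝ)).symm
      (A I + fderiv ℝ (gradient p) x)) z := by
    have h1 : Continuous (Matrix.toEuclideanCLM (n := Fin n) (𝕜 := ℝ)).symm :=
      LinearMap.continuous_of_finiteDimensional
        (Matrix.toEuclideanCLM (n := Fin n) (𝕜 := ℝ)).symm.toAlgEquiv.toLinearMap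
    exact h1.continuousAt.comp
      (continuousAt_const.add (contDiffAt_fderiv_gradient hp).continuousAt)
  refine (hc.tendsto.comp hlim').congr fun i => ?_
  exact (h.twiceDiffAt_add (hN _ (Nat.le_add_left _ _)) (hu _)).2.symm

/-- Pigeonhole: along a sequence of points tending to `z`, one of the finitely many cells occurs
infinitely often and contains `z`; the Hessian identity on that cell passes to the limit. -/
theorem toEuclideanCLM_mem_convexHull [Finite ι] (h : PiecewiseAffineGradient f P A) {z : Vec n}
    (hp : ContDiffAt ℝ 3 p z) {H : Matrix (Fin n) (Fin n) ℝ}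
    (hH : H ∈ genHessian (fun x => f x + p x) z) :
    Matrix.toEuclideanCLM (n := Fin n) (𝕜 := ℝ) H ∈
      convexHull ℝ {B | ∃ I, (interior (P I)).Nonempty ∧ z ∈ P I ∧
        B = A I + fderiv ℝ (gradient p) z} := by
  set Φ := (Matrix.toEuclideanCLM (n := Fin n) (𝕜 := ℝ)).toAlgEquiv.toLinearMap with hΦ
  have hcont : Continuous Φ := LinearMap.continuous_of_finiteDimensional Φ
  suffices hs : genHessian (fun x => f x + p x) z ⊆ Φ ⁻¹' convexHull ℝ
      {B | ∃ I, (interior (P I)).Nonempty ∧ z ∈ P I ∧ B = A I + fderiv ℝ (gradient p) z} from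
    hs hH
  refine convexHull_min ?_ ((convex_convexHull ℝ _).linear_preimage Φ)
  rintro H ⟨u, hu, htd, hlim⟩
  refine subset_convexHull ℝ _ ?_
  -- The identity is phrased as membership in the closed set `{0}`, which survives limits taken
  -- along frequently occurring indices.
  have hev : ∀ᶠ i in atTop, ∃ I, (interior (P I)).Nonempty ∧ z ∈ P I ∧
      Φ (hessian (fun x => f x + p x) (u i)) - (A I + fderiv ℝ (gradient p) (u i)) ∈
        ({0} : Set (Vec n →L[ℝ] Vec n)) := by
    filter_upwards [hu.eventually (h.eventually_mem z), hu.eventually (eventually_contDiffAt hp)]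
      with i h1 h2
    obtain ⟨I, hI, hzI⟩ := h.exists_full_mem (u i)
    refine ⟨I, hI, h1 I hzI, ?_⟩
    rw [Set.mem_singleton_iff, sub_eq_zero, ← h.fderiv_gradient_add h2 hI hzI (htd i)]
    exact (Matrix.toEuclideanCLM (n := Fin n) (𝕜 := ℝ)).apply_symm_apply _
  obtain ⟨I, hI⟩ : ∃ I, ∃ᶠ i in atTop, (interior (P I)).Nonempty ∧ z ∈ P I ∧
      Φ (hessian (fun x => f x + p x) (u i)) - (A I + fderiv ℝ (gradient p) (u i)) ∈
        ({0} : Set (Vec n →L[ℝ] Vec n)) := by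
    by_contra hne
    simp only [not_exists, not_frequently] at hne
    obtain ⟨i, hi, I, hI⟩ := ((eventually_all.2 hne).and hev).exists
    exact hi I hI
  obtain ⟨i, hi1, hi2, -⟩ := hI.exists
  refine ⟨I, hi1, hi2, ?_⟩
  have hl : Tendsto (fun i => Φ (hessian (fun x => f x + p x) (u i)) -
      (A I + fderiv ℝ (gradient p) (u i))) atTop
      (𝓝 (Φ H - (A I + fderiv ℝ (gradient p) z))) :=
    ((hcont.tendsto H).comp hlim).sub (tendsto_const_nhds.add
      ((contDiffAt_fderiv_gradient hp).continuousAt.tendsto.comp hu))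
  have := isClosed_singleton.mem_of_frequently_of_tendsto (hI.mono fun _ h => h.2.2) hl
  exact sub_eq_zero.1 this

end PiecewiseAffineGradient

end PSNP

/-! ### Quadratic bounds along segments -/

namespace PSNP

/-- A lower bound on the right slopes of the derivative gives a quadratic lower bound. -/
theorem quadratic_lower_of_right_slope {ψ θ : ℝ → ℝ} {c : ℝ}
    (hψ : ∀ t ∈ Set.Icc (0 : ℝ) 1, HasDerivAt ψ (θ t) t)
    (hθ : ContinuousOn θ (Set.Icc 0 1))
    (hs : ∀ t ∈ Set.Ico (0 : ℝ) 1, ∀ r < c, ∀ᶠ s in 𝓝[>] t, r * (s - t) ≤ θ s - θ t) :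
    θ 0 + c ≤ θ 1 ∧ ψ 0 + θ 0 + c / 2 ≤ ψ 1 := by
  have key : ∀ t ∈ Set.Icc (0 : ℝ) 1, -θ t ≤ -(θ 0 + c * t) := by
    intro t ht
    refine image_le_of_liminf_slope_right_le_deriv_boundary (f := fun t => -θ t)
      (B := fun t => -(θ 0 + c * t)) (B' := fun _ => -c) hθ.neg (by simp) (by fun_prop)
      (fun x _ => ?_) (fun x hx r hr => ?_) ht
    · refine HasDerivAt.hasDerivWithinAt ?_
      simpa using (((hasDerivAt_id' x).const_mul c).const_add (θ 0)).fun_neg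
    · refine Eventually.frequently ?_
      -- The midpoint of `-c` and `r` leaves room on both sides, as the comparison lemma needs a
      -- strict slope inequality.
      filter_upwards [hs x hx (-((r + -c) / 2)) (by linarith), self_mem_nhdsWithin] with s h1 h2
      have h3 : 0 < s - x := sub_pos.2 h2
      rw [slope_def_field, div_lt_iff₀ h3]
      nlinarith
  refine ⟨by linarith [key 1 (by simp)], ?_⟩
  have h2 : -ψ 1 ≤ -(ψ 0 + (θ 0 * 1 + c / 2 * 1 ^ 2)) := by
    refine image_le_of_deriv_right_le_deriv_boundary (a := 0) (b := 1) (f := fun t => -ψ t)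
      (f' := fun t => -θ t) (B := fun t => -(ψ 0 + (θ 0 * t + c / 2 * t ^ 2)))
      (B' := fun t => -(θ 0 + c * t)) ?_
      (fun t ht => (hψ t (Set.Ico_subset_Icc_self ht)).neg.hasDerivWithinAt) (by simp)
      (by fun_prop) (fun t _ => ?_) (fun t ht => key t (Set.Ico_subset_Icc_self ht)) (by simp)
    · exact fun t ht => (hψ t ht).neg.continuousAt.continuousWithinAt
    · refine HasDerivAt.hasDerivWithinAt ?_
      convert ((((hasDerivAt_id' t).const_mul (θ 0)).fun_add
        (((hasDerivAt_id' t).fun_pow 2).const_mul (c / 2))).const_add (ψ 0)).fun_neg using 1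
      norm_num
      ring
  linarith

namespace PiecewiseAffineGradient

variable {n : ℕ} {ι : Type*} [Finite ι] {f : Vec n → ℝ} {P : ι → Set (Vec n)}
  {A : ι → Vec n →L[ℝ] Vec n} {p : Vec n → ℝ}

/-- The gradient need not be differentiable along the segment, but its right slopes are controlled:
a cell containing `a + s • d` for `s` near `t` also contains `a + t • d`, so `∇f` changes by exactly
`(s - t) • A I d`. -/
theorem quadratic_lower (h : PiecewiseAffineGradient f P A) {a b : Vec n} {c : ℝ}
    (hp : ∀ t ∈ Set.Icc (0 : ℝ) 1, ContDiffAt ℝ 3 p (a + t • (b - a)))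
    (hpos : ∀ t ∈ Set.Ico (0 : ℝ) 1, ∀ I, (interior (P I)).Nonempty → a + t • (b - a) ∈ P I →
      c * ‖b - a‖ ^ 2 ≤
        inner ℝ ((A I + fderiv ℝ (gradient p) (a + t • (b - a))) (b - a)) (b - a)) :
    inner ℝ (gradient f a + gradient p a) (b - a) + c * ‖b - a‖ ^ 2 ≤
        inner ℝ (gradient f b + gradient p b) (b - a) ∧
      f a + p a + inner ℝ (gradient f a + gradient p a) (b - a) + c / 2 * ‖b - a‖ ^ 2 ≤
        f b + p b := by
  set d := b - a with hd
  have hline : ∀ t : ℝ, HasDerivAt (fun t : ℝ => a + t • d) d t := by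
    intro t
    simpa using ((hasDerivAt_id t).smul_const d).const_add a
  have hgp : ∀ t ∈ Set.Icc (0 : ℝ) 1, HasDerivAt
      (fun t => gradient p (a + t • d)) (fderiv ℝ (gradient p) (a + t • d) d) t := by
    intro t ht
    exact ((contDiffAt_gradient (hp t ht)).differentiableAt
      (by norm_num)).hasFDerivAt.comp_hasDerivAt t (hline t)
  have key := quadratic_lower_of_right_slope
    (ψ := fun t => f (a + t • d) + p (a + t • d))
    (θ := fun t => inner ℝ (gradient f (a + t • d) + gradient p (a + t • d)) d)
    (c := c * ‖d‖ ^ 2) ?_ ?_ ?_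
  · have h1 : a + d = b := by rw [hd]; abel
    simp only [zero_smul, add_zero, one_smul, h1] at key
    refine ⟨key.1, le_trans (le_of_eq ?_) key.2⟩
    ring
  · intro t ht
    have h1 : HasGradientAt (fun x => f x + p x)
        (gradient f (a + t • d) + gradient p (a + t • d)) (a + t • d) := by
      have hfd := h.differentiable.differentiableAt (x := a + t • d)
      have hpd := (hp t ht).differentiableAt (by norm_num)
      rw [← gradient_add' hfd hpd]
      exact (hfd.add hpd).hasGradientAt
    have h2 := h1.hasFDerivAt.comp_hasDerivAt t (hline t)
    exact h2.congr_deriv (InnerProductSpace.toDual_apply_apply ..)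
  · intro t ht
    refine ContinuousAt.continuousWithinAt (ContinuousAt.inner ?_ continuousAt_const)
    refine ContinuousAt.add ?_ (hgp t ht).continuousAt
    exact h.continuous_gradient.continuousAt.comp (hline t).continuousAt
  · intro t ht r hr
    have htI := Set.Ico_subset_Icc_self ht
    set z := a + t • d with hz
    have hfe : ∀ᶠ s in 𝓝 t, ∀ I, a + s • d ∈ P I → z ∈ P I :=
      (hline t).continuousAt.eventually (h.eventually_mem z)
    have hpi : HasDerivAt (fun s => inner ℝ (gradient p (a + s • d)) d)
        (inner ℝ (fderiv ℝ (gradient p) z d) d) t := by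
      simpa using (hgp t htI).inner ℝ (hasDerivAt_const t d)
    have hslope := (hasDerivAt_iff_tendsto_slope.1 hpi).mono_left
      (nhdsWithin_mono t (s := Set.Ioi t) fun s hs => ne_of_gt hs)
    -- The slack `c * ‖d‖ ^ 2 - r` is spent on the smooth part, because `f` contributes no error.
    have hev := hslope.eventually (lt_mem_nhds (b := inner ℝ (fderiv ℝ (gradient p) z d) d)
      (a := inner ℝ (fderiv ℝ (gradient p) z d) d - (c * ‖d‖ ^ 2 - r)) (by linarith))
    filter_upwards [hev, hfe.filter_mono nhdsWithin_le_nhds, self_mem_nhdsWithin] with s h1 h2 h3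
    have hst : 0 < s - t := sub_pos.2 h3
    rw [slope_def_field, lt_div_iff₀ hst] at h1
    obtain ⟨I, hI, hsI⟩ := h.exists_full_mem (a + s • d)
    have hzI := h2 I hsI
    have h4 := h.gradient_sub I _ hsI z hzI
    have h5 : a + s • d - z = (s - t) • d := by rw [hz, sub_smul]; abel
    rw [h5, map_smul] at h4
    have h6 := hpos t ht I hI hzI
    rw [add_apply, inner_add_left] at h6
    have h7 : inner ℝ (gradient f (a + s • d)) d - inner ℝ (gradient f z) d =
        (s - t) * inner ℝ (A I d) d := by
      rw [← inner_sub_left, h4, real_inner_smul_left]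
    simp only [inner_add_left]
    nlinarith

/-- The descent inequality, from an upper bound on the Hessians along the segment. -/
theorem quadratic_upper (h : PiecewiseAffineGradient f P A) {a b : Vec n} {c : ℝ}
    (hpos : ∀ t ∈ Set.Ico (0 : ℝ) 1, ∀ I, (interior (P I)).Nonempty → a + t • (b - a) ∈ P I →
      inner ℝ (A I (b - a)) (b - a) ≤ c * ‖b - a‖ ^ 2) :
    f b ≤ f a + inner ℝ (gradient f a) (b - a) + c / 2 * ‖b - a‖ ^ 2 := by
  have h0 := gradient_zero_fun (n := n)
  have key := (h.neg.quadratic_lower (p := fun _ => 0) (a := a) (b := b) (c := -c)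
    (fun _ _ => contDiffAt_const) (fun t ht I hI hz => ?_)).2
  · have hg : gradient (fun x => -f x) a = -gradient f a := by
      simp only [gradient]
      rw [fderiv_fun_neg, map_neg]
    simp only [hg, h0, add_zero, inner_neg_left] at key
    linarith
  · have := hpos t ht I hI hz
    rw [h0]
    simp only [fderiv_fun_const, Pi.zero_apply, add_zero, neg_apply, inner_neg_left]
    linarith

end PiecewiseAffineGradient

end PSNP

/-! ### The squared-hinge objective -/

namespace PSNP

noncomputable section

theorem hasDerivAt_max_sq (t : ℝ) : HasDerivAt (fun s : ℝ => max s 0 ^ 2) (2 * max t 0) t := by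
  rcases lt_trichotomy t 0 with ht | rfl | ht
  · rw [max_eq_right ht.le, mul_zero]
    refine (hasDerivAt_const t (0 : ℝ)).congr_of_eventuallyEq ?_
    filter_upwards [gt_mem_nhds ht] with s hs
    simp [max_eq_right hs.le]
  · rw [hasDerivAt_iff_isLittleO_nhds_zero]
    have h : (fun s : ℝ => s ^ 2) =o[𝓝 0] fun s => s := by
      simpa using Asymptotics.isLittleO_pow_id (one_lt_two)
    refine Asymptotics.IsBigO.trans_isLittleO (Asymptotics.IsBigO.of_bound 1 ?_) h
    refine Eventually.of_forall fun s => ?_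
    simp only [zero_add, max_self, mul_zero, smul_zero, sub_zero, one_mul, norm_pow,
      Real.norm_eq_abs, ne_eq, OfNat.ofNat_ne_zero, not_false_eq_true, zero_pow]
    refine pow_le_pow_left₀ (abs_nonneg _) ?_ 2
    rw [abs_of_nonneg (le_max_right s 0)]
    exact max_le (le_abs_self s) (abs_nonneg s)
  · rw [max_eq_left ht.le]
    have h := (hasDerivAt_id' t).fun_pow 2
    norm_num at h
    refine h.congr_of_eventuallyEq ?_
    filter_upwards [lt_mem_nhds ht] with s hs
    simp [max_eq_left hs.le]

variable {n m : ℕ} (a : Fin m → Vec n) (y : Fin m → ℝ) (μ : ℝ)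

/-- The gradient of the squared-hinge objective. -/
def svmGrad (x : Vec n) : Vec n :=
  (1 / (m : ℝ)) • ∑ i, (-(y i) * max (1 - y i * inner ℝ (a i) x) 0) • a i + μ • x

/-- The region on which exactly the terms in `I` are (weakly) active. -/
def svmCell (I : Finset (Fin m)) : Set (Vec n) :=
  {x | ∀ i, (i ∈ I → 0 ≤ 1 - y i * inner ℝ (a i) x) ∧ (i ∉ I → 1 - y i * inner ℝ (a i) x ≤ 0)}

/-- The Hessian of the squared-hinge objective on `svmCell a y I`. -/
def svmHess (I : Finset (Fin m)) : Vec n →L[ℝ] Vec n :=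
  (1 / (m : ℝ)) • ∑ i ∈ I, (y i) ^ 2 • (innerSL ℝ (a i)).smulRight (a i) +
    μ • ContinuousLinearMap.id ℝ (Vec n)

theorem hasGradientAt_fsvm (x : Vec n) : HasGradientAt (fsvm a y μ) (svmGrad a y μ x) x := by
  rw [hasGradientAt_iff_hasFDerivAt]
  have h1 : ∀ i ∈ (Finset.univ : Finset (Fin m)), HasFDerivAt
      (fun x : Vec n => max (1 - y i * inner ℝ (a i) x) 0 ^ 2)
      ((2 * max (1 - y i * inner ℝ (a i) x) 0) • -(y i • innerSL ℝ (a i))) x := by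
    intro i _
    have h2 : HasFDerivAt (fun x : Vec n => 1 - y i * inner ℝ (a i) x)
        (-(y i • innerSL ℝ (a i))) x := by
      have := ((innerSL ℝ (a i)).hasFDerivAt (x := x)).const_mul (y i)
      simpa using this.const_sub 1
    exact (hasDerivAt_max_sq _).comp_hasFDerivAt x h2
  have h3 := (HasFDerivAt.fun_sum h1).const_mul (1 / (2 * (m : ℝ)))
  have h4 := ((hasStrictFDerivAt_norm_sq x).hasFDerivAt).const_mul (μ / 2)
  refine (h3.fun_add h4).congr_fderiv ?_
  ext v
  simp only [svmGrad, add_apply, smul_apply, sum_apply, neg_apply,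
    innerSL_apply_apply, smul_eq_mul, InnerProductSpace.toDual_apply_apply, inner_add_left,
    real_inner_smul_left, sum_inner, Finset.mul_sum]
  congr 1
  · refine Finset.sum_congr rfl fun i _ => ?_
    ring
  · simp; ring

theorem gradient_fsvm : gradient (fsvm a y μ) = svmGrad a y μ :=
  gradient_eq (hasGradientAt_fsvm a y μ)

/-- The sign pattern on a cell resolves every maximum. At a kink both branches vanish, so closed
overlapping cells are consistent. -/
theorem piecewiseAffineGradient_fsvm :
    PiecewiseAffineGradient (fsvm a y μ) (svmCell a y) (svmHess a y μ) where
  differentiable x := (hasGradientAt_fsvm a y μ x).differentiableAt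
  isClosed I := by
    simp only [svmCell, Set.ofPred_forall, Set.ofPred_and]
    refine isClosed_iInter fun i => IsClosed.inter ?_ ?_
    · refine isClosed_iInter fun _ => isClosed_le continuous_const (by fun_prop)
    · refine isClosed_iInter fun _ => isClosed_le (by fun_prop) continuous_const
  convex I := by
    intro x hx z hz s t hs ht hst i
    have key : 1 - y i * inner ℝ (a i) (s • x + t • z) =
        s * (1 - y i * inner ℝ (a i) x) + t * (1 - y i * inner ℝ (a i) z) := by
      rw [inner_add_right, real_inner_smul_right, real_inner_smul_right]
      linear_combination -hst
    rw [key]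
    refine ⟨fun hi => ?_, fun hi => ?_⟩
    · have := (hx i).1 hi
      have := (hz i).1 hi
      positivity
    · have := mul_nonneg hs (neg_nonneg.2 ((hx i).2 hi))
      have := mul_nonneg ht (neg_nonneg.2 ((hz i).2 hi))
      linarith
  cover z := by
    refine ⟨Finset.univ.filter fun i => 0 ≤ 1 - y i * inner ℝ (a i) z, fun i => ?_⟩
    simp only [Finset.mem_filter, Finset.mem_univ, true_and, not_le]
    exact ⟨id, le_of_lt⟩
  gradient_sub I z hz z' hz' := by
    have key : ∀ x ∈ svmCell a y I, svmGrad a y μ x =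
        (1 / (m : ℝ)) • ∑ i ∈ I, (-(y i) * (1 - y i * inner ℝ (a i) x)) • a i + μ • x := by
      intro x hx
      rw [svmGrad, ← Finset.sum_subset (Finset.subset_univ I)]
      · congr 2
        refine Finset.sum_congr rfl fun i hi => ?_
        rw [max_eq_left ((hx i).1 hi)]
      · intro i _ hi
        rw [max_eq_right ((hx i).2 hi)]
        simp
    rw [gradient_fsvm, key z hz, key z' hz', svmHess]
    simp only [add_apply, smul_apply, sum_apply,
      ContinuousLinearMap.smulRight_apply, innerSL_apply_apply, ContinuousLinearMap.id_apply]
    rw [add_sub_add_comm, ← smul_sub, ← smul_sub, ← Finset.sum_sub_distrib]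
    congr 2
    refine Finset.sum_congr rfl fun i _ => ?_
    rw [← sub_smul, smul_smul, inner_sub_right]
    congr 1
    ring

theorem svmHess_inner_ge (I : Finset (Fin m)) (v : Vec n) :
    μ * ‖v‖ ^ 2 ≤ inner ℝ (svmHess a y μ I v) v := by
  simp only [svmHess, add_apply, smul_apply, sum_apply,
      ContinuousLinearMap.smulRight_apply, innerSL_apply_apply, ContinuousLinearMap.id_apply,
      inner_add_left, real_inner_smul_left, sum_inner, real_inner_self_eq_norm_sq]
  refine le_add_of_nonneg_left (mul_nonneg (by positivity) (Finset.sum_nonneg fun i _ => ?_))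
  exact mul_nonneg (sq_nonneg _) (mul_self_nonneg _)

theorem mul_norm_sq_le_fsvm (x : Vec n) : μ / 2 * ‖x‖ ^ 2 ≤ fsvm a y μ x := by
  refine le_add_of_nonneg_left ?_
  positivity

theorem gradient_fsvm_strongly_monotone (x z : Vec n) :
    μ * ‖z - x‖ ^ 2 ≤ inner ℝ (gradient (fsvm a y μ) z - gradient (fsvm a y μ) x) (z - x) := by
  have h0 := gradient_zero_fun (n := n)
  have h := ((piecewiseAffineGradient_fsvm a y μ).quadratic_lower (p := fun _ => 0)
    (a := x) (b := z) (c := μ) (fun _ _ => contDiffAt_const) (fun t ht I hI hz => ?_)).1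
  · simp only [h0, add_zero] at h
    rw [inner_sub_left]
    linarith
  · rw [h0]
    simpa using svmHess_inner_ge a y μ I (z - x)

end

end PSNP

/-! ### The `L_q` penalty, stationarity and lower bounds for proximal entries -/

namespace PSNP

noncomputable section

theorem absPow_zero (q : ℝ) : absPow q 0 = 0 := if_pos rfl

theorem absPow_of_ne {q t : ℝ} (ht : t ≠ 0) : absPow q t = |t| ^ q := if_neg ht

theorem absPow_nonneg (q t : ℝ) : 0 ≤ absPow q t := by
  unfold absPow
  split_ifs
  · rfl
  · positivity

theorem absPow_eventuallyEq {q t : ℝ} (ht : t ≠ 0) : absPow q =ᶠ[𝓝 t] fun s => |s| ^ q := by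
  filter_upwards [isOpen_ne.mem_nhds ht] with s hs
  exact absPow_of_ne hs

theorem contDiffAt_absPow {q t : ℝ} (ht : t ≠ 0) : ContDiffAt ℝ 3 (absPow q) t := by
  refine ContDiffAt.congr_of_eventuallyEq ?_ (absPow_eventuallyEq ht)
  exact (contDiffAt_abs ht).rpow_const_of_ne (abs_ne_zero.2 ht)

theorem hasDerivAt_absPow {q t : ℝ} (ht : t ≠ 0) :
    HasDerivAt (absPow q) (q * |t| ^ q / t) t := by
  refine HasDerivAt.congr_of_eventuallyEq ?_ (absPow_eventuallyEq ht)
  have h := (hasDerivAt_abs ht).rpow_const (p := q) (Or.inl (abs_ne_zero.2 ht))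
  refine h.congr_deriv ?_
  rw [Real.rpow_sub_one (abs_ne_zero.2 ht)]
  rcases lt_or_gt_of_ne ht with h | h
  · rw [abs_of_neg h, sign_neg h]
    field_simp
    simp
  · rw [abs_of_pos h, sign_pos h]
    simp
    ring

/-- The quotient `|t| / |t|^q = |t|^(1-q)` tends to zero. This is how `q < 1` forces sparsity: near
zero the penalty beats any linear gain. -/
theorem eventually_mul_abs_le_absPow {q : ℝ} (hq1 : q < 1) (K : ℝ) :
    ∀ᶠ t in 𝓝 (0 : ℝ), K * |t| ≤ absPow q t := by
  have h : Tendsto (fun t : ℝ => K * |t| ^ (1 - q)) (𝓝 0) (𝓝 0) := by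
    have h1 : Continuous fun t : ℝ => K * |t| ^ (1 - q) :=
      continuous_const.mul (continuous_abs.rpow_const fun _ => Or.inr (by linarith))
    have := h1.tendsto 0
    rwa [abs_zero, Real.zero_rpow (by linarith), mul_zero] at this
  filter_upwards [h.eventually (gt_mem_nhds one_pos)] with t ht
  by_cases h0 : t = 0
  · simp [h0, absPow_zero]
  · have h1 : 0 < |t| := abs_pos.2 h0
    have h2 : |t| = |t| ^ (1 - q) * |t| ^ q := by
      rw [← Real.rpow_add h1]; simp
    rw [absPow_of_ne h0]
    calc K * |t| = (K * |t| ^ (1 - q)) * |t| ^ q := by rw [mul_assoc, ← h2]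
      _ ≤ 1 * |t| ^ q := by gcongr
      _ = |t| ^ q := one_mul _

variable {n : ℕ}

theorem mem_supp {x : Vec n} {i : Fin n} : i ∈ supp x ↔ x i ≠ 0 := by simp [supp]

theorem lqOn_nonneg (q : ℝ) (S : Finset (Fin n)) (x : Vec n) : 0 ≤ lqOn q S x :=
  Finset.sum_nonneg fun _ _ => absPow_nonneg _ _

theorem lq_nonneg (q : ℝ) (x : Vec n) : 0 ≤ lq q x := lqOn_nonneg _ _ _

theorem lq_eq_lqOn {q : ℝ} {S : Finset (Fin n)} {x : Vec n} (hx : ∀ i, i ∉ S → x i = 0) :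
    lq q x = lqOn q S x := by
  refine (Finset.sum_subset (Finset.subset_univ S) fun i _ hi => ?_).symm
  rw [hx i hi, absPow_zero]

theorem lq_eq_add (q : ℝ) (S : Finset (Fin n)) (x : Vec n) :
    lq q x = lqOn q S x + lqOn q Sᶜ x :=
  (Finset.sum_add_sum_compl S _).symm

theorem contDiffAt_apply (i : Fin n) (x : Vec n) : ContDiffAt ℝ 3 (fun z : Vec n => z i) x :=
  (EuclideanSpace.proj (𝕜 := ℝ) i).contDiff.contDiffAt

theorem contDiffAt_lqOn {q lam : ℝ} {S : Finset (Fin n)} {x : Vec n} (hx : ∀ i ∈ S, x i ≠ 0) :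
    ContDiffAt ℝ 3 (fun z => lam * lqOn q S z) x := by
  refine contDiffAt_const.mul (ContDiffAt.sum fun i hi => ?_)
  exact (contDiffAt_absPow (hx i hi)).comp x (contDiffAt_apply i x)

theorem hasDerivAt_apply_line (x : Vec n) (i j : Fin n) :
    HasDerivAt (fun t : ℝ => (x + t • EuclideanSpace.single i (1 : ℝ)) j)
      (if j = i then 1 else 0) 0 := by
  have : (fun t : ℝ => (x + t • EuclideanSpace.single i (1 : ℝ)) j) =
      fun t => x j + t * (if j = i then 1 else 0) := by
    ext t
    simp
  rw [this]
  simpa using ((hasDerivAt_id' (0 : ℝ)).mul_const (if j = i then (1 : ℝ) else 0)).const_add (x j)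

theorem gradient_lqOn_apply {q lam : ℝ} {S : Finset (Fin n)} {x : Vec n}
    (hx : ∀ i ∈ S, x i ≠ 0) {i : Fin n} (hi : i ∈ S) :
    gradient (fun z => lam * lqOn q S z) x i = lam * (q * |x i| ^ q / x i) := by
  have hline : HasDerivAt (fun t : ℝ => x + t • EuclideanSpace.single i (1 : ℝ))
      (EuclideanSpace.single i 1) 0 := by
    simpa using ((hasDerivAt_id (0 : ℝ)).smul_const (EuclideanSpace.single i (1 : ℝ))).const_add x
  have hfd := ((contDiffAt_lqOn (q := q) (lam := lam) hx).differentiableAt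
    (by norm_num)).hasFDerivAt
  have h1 := HasFDerivAt.comp_hasDerivAt_of_eq (0 : ℝ) hfd hline (by simp)
  rw [gradient_apply]
  refine h1.unique ?_
  have h2 : ∀ j ∈ S, HasDerivAt
      (fun t : ℝ => absPow q ((x + t • EuclideanSpace.single i (1 : ℝ)) j))
      (q * |x j| ^ q / x j * (if j = i then 1 else 0)) 0 := fun j hj =>
    HasDerivAt.comp_of_eq (0 : ℝ) (hasDerivAt_absPow (hx j hj)) (hasDerivAt_apply_line x i j)
      (by simp)
  refine ((HasDerivAt.fun_sum h2).const_mul lam).congr_deriv ?_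
  simp [hi]

/-- Stationarity on the support at a local minimizer of a smooth function plus a multiple of
the `L_q` penalty. -/
theorem stationary_of_isLocalMin {q r : ℝ} {h : Vec n → ℝ} {g x : Vec n}
    (hg : HasGradientAt h g x) (hmin : IsLocalMin (fun z => h z + r * lq q z) x) {i : Fin n}
    (hi : x i ≠ 0) : g i + r * (q * |x i| ^ q / x i) = 0 := by
  have hline : HasDerivAt (fun t : ℝ => x + t • EuclideanSpace.single i (1 : ℝ))
      (EuclideanSpace.single i 1) 0 := by
    simpa using ((hasDerivAt_id (0 : ℝ)).smul_const (EuclideanSpace.single i (1 : ℝ))).const_add x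
  have h1 := HasFDerivAt.comp_hasDerivAt_of_eq (0 : ℝ) hg.hasFDerivAt hline (by simp)
  have h2 : ∀ j, HasDerivAt (fun t : ℝ => absPow q ((x + t • EuclideanSpace.single i (1 : ℝ)) j))
      (if j = i then q * |x i| ^ q / x i else 0) 0 := by
    intro j
    by_cases hj : j = i
    · subst hj
      have := HasDerivAt.comp_of_eq (0 : ℝ) (hasDerivAt_absPow (q := q) hi)
        (hasDerivAt_apply_line x j j) (by simp)
      simpa [Function.comp_def] using this
    · have : (fun t : ℝ => absPow q ((x + t • EuclideanSpace.single i (1 : ℝ)) j)) =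
          fun _ => absPow q (x j) := by
        ext t
        simp [hj]
      rw [this, if_neg hj]
      exact hasDerivAt_const _ _
  have h3 := (HasDerivAt.fun_sum (u := Finset.univ) fun j _ => h2 j).const_mul r
  have h4 := h1.fun_add h3
  have h5 : IsLocalMin (fun t : ℝ => h (x + t • EuclideanSpace.single i (1 : ℝ)) +
      r * lq q (x + t • EuclideanSpace.single i (1 : ℝ))) 0 := by
    have hc : ContinuousAt (fun t : ℝ => x + t • EuclideanSpace.single i (1 : ℝ)) 0 :=
      hline.continuousAt
    have h6 : Tendsto (fun t : ℝ => x + t • EuclideanSpace.single i (1 : ℝ)) (𝓝 0) (𝓝 x) := by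
      simpa using hc.tendsto
    have := h6.eventually hmin
    simpa [IsLocalMin, IsMinFilter] using this
  have h6 := h5.hasDerivAt_eq_zero h4
  simpa [EuclideanSpace.inner_single_right, InnerProductSpace.toDual_apply_apply] using h6

/-- Compare `w` with the vector obtained by deleting its `i`-th entry. -/
theorem prox_apply_le {q r : ℝ} {u w : Vec n}
    (hw : w ∈ prox (fun z => r * lq q z) u) (i : Fin n) :
    r * absPow q (w i) ≤ |u i| * |w i| := by
  have h := hw (w - EuclideanSpace.single i (w i))
  simp only at h
  have h1 : lq q w - lq q (w - EuclideanSpace.single i (w i)) = absPow q (w i) := by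
    simp only [lq, lqOn]
    rw [← Finset.sum_sub_distrib, Finset.sum_eq_single i]
    · simp [absPow_zero]
    · intro j _ hj
      simp [hj]
    · simp
  have h2 : ‖u - (w - EuclideanSpace.single i (w i))‖ ^ 2 =
      ‖u - w‖ ^ 2 + 2 * ((u i - w i) * w i) + w i ^ 2 := by
    have : u - (w - EuclideanSpace.single i (w i)) = (u - w) + EuclideanSpace.single i (w i) := by
      abel
    rw [this, norm_add_sq_real, EuclideanSpace.inner_single_right]
    simp
    ring
  have h3 : u i * w i ≤ |u i| * |w i| := by rw [← abs_mul]; exact le_abs_self _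
  have h4 : r * absPow q (w i) = r * lq q w - r * lq q (w - EuclideanSpace.single i (w i)) := by
    rw [← h1]; ring
  nlinarith [sq_nonneg (w i)]

/-- Nonzero entries of proximal points of bounded arguments are bounded away from zero. -/
theorem exists_prox_lower_bound {q r : ℝ} (hq1 : q < 1) (hr : 0 < r) (B : ℝ) :
    ∃ ν > 0, ∀ u w : Vec n, ‖u‖ ≤ B → w ∈ prox (fun z => r * lq q z) u →
      ∀ i, w i ≠ 0 → ν ≤ |w i| := by
  obtain ⟨ν, hν, h⟩ := Metric.eventually_nhds_iff.1
    -- With `B + 1` in place of `B`, the two bounds on `r * absPow q (w i)` contradict each other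
    -- strictly.
    (eventually_mul_abs_le_absPow hq1 ((B + 1) / r))
  refine ⟨ν, hν, fun u w hu hw i hi => ?_⟩
  by_contra! hlt
  have h1 := h (show dist (w i) 0 < ν by simpa using hlt)
  have h2 := prox_apply_le hw i
  have h3 : |u i| ≤ B := (PiLp.norm_apply_le u i).trans hu
  have h4 : 0 < |w i| := abs_pos.2 hi
  have h5 : (B + 1) * |w i| ≤ r * absPow q (w i) := by
    calc (B + 1) * |w i| = r * ((B + 1) / r * |w i|) := by field_simp
      _ ≤ _ := by gcongr
  nlinarith

/-- Near `x`, a point whose nonzero entries are bounded away from zero has the support of `x`. -/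
theorem eventually_supp_eq {ν : ℝ} (hν : 0 < ν) (x : Vec n) :
    ∀ᶠ z in 𝓝 x, supp x ⊆ supp z ∧ ((∀ i, z i ≠ 0 → ν ≤ |z i|) → supp z = supp x) := by
  have h1 : ∀ᶠ z in 𝓝 x, ∀ i, |z i - x i| < ν := by
    filter_upwards [Metric.ball_mem_nhds x hν] with z hz i
    have := PiLp.norm_apply_le (z - x) i
    rw [mem_ball_iff_norm] at hz
    exact lt_of_le_of_lt (by simpa using this) hz
  have h2 : ∀ᶠ z in 𝓝 x, ∀ i ∈ supp x, z i ≠ 0 := by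
    rw [Filter.eventually_all_finset]
    intro i hi
    exact (contDiffAt_apply i x).continuousAt.eventually_ne (mem_supp.1 hi)
  filter_upwards [h1, h2] with z hz1 hz2
  have hsub : supp x ⊆ supp z := fun i hi => mem_supp.2 (hz2 i hi)
  refine ⟨hsub, fun h => Finset.Subset.antisymm (fun i hi => ?_) hsub⟩
  by_contra hx
  have hxi : x i = 0 := by simpa [mem_supp] using hx
  have := hz1 i
  rw [hxi, sub_zero] at this
  exact absurd (h i (mem_supp.1 hi)) (not_le.2 this)

end

end PSNP

/-! ### Level sets, step size and sufficient decrease -/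

namespace PSNP

noncomputable section

variable {n : ℕ}

theorem NewtonPhase.objF_le {f : Vec n → ℝ} {q lam σ γ : ℝ} {w x' : Vec n}
    (h : NewtonPhase f q lam σ γ w x') :
    objF f q lam x' ≤ objF f q lam w - σ / 2 * ‖x' - w‖ ^ 2 := by
  obtain ⟨M, -, ⟨d, -, s, hs, rfl⟩ | ⟨-, -, -, rfl⟩ | ⟨-, rfl⟩⟩ := h
  · have := hs.1
    simp only [Set.mem_ofPred_eq, Admissible] at this
    have h2 : ‖w - γ ^ s • d - w‖ = ‖γ ^ s • d‖ := by rw [← norm_neg]; congr 1; abel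
    rwa [h2]
  · simp
  · simp

theorem NewtonPhase.apply_eq_zero {f : Vec n → ℝ} {q lam σ γ : ℝ} {w x' : Vec n}
    (h : NewtonPhase f q lam σ γ w x') {i : Fin n} (hi : i ∉ supp w) : x' i = 0 := by
  have hw : w i = 0 := by simpa [mem_supp] using hi
  obtain ⟨M, -, ⟨d, hd, s, hs, rfl⟩ | ⟨-, -, -, rfl⟩ | ⟨-, rfl⟩⟩ := h
  · simp [hw, hd.2 i hi]
  · exact hw
  · exact hw

/-- This explains the factor 5 in `c0`. Comparison with the competitor `x` bounds the residual `e`,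
and Cauchy–Schwarz with weights 1/5, 2/5, 2/5 bounds the square of `‖x‖ + α‖g‖ + ‖e‖`. -/
theorem norm_sq_le_of_mem_prox {q lam α τ : ℝ} (hα0 : 0 < α) (hατ : α ≤ τ) (hlam : 0 < lam)
    {x g w : Vec n} (hw : w ∈ prox (fun z => α * lam * lq q z) (x - α • g)) :
    ‖w‖ ^ 2 ≤ 5 * (‖x‖ ^ 2 + τ ^ 2 * ‖g‖ ^ 2 + τ * lam * lq q x) := by
  have h := hw x
  have h1 : ‖x - α • g - x‖ = α * ‖g‖ := by
    rw [show x - α • g - x = -(α • g) by abel, norm_neg, norm_smul, Real.norm_of_nonneg hα0.le]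
  simp only [h1] at h
  set e := x - α • g - w with he
  have h2 : ‖w‖ ≤ ‖x‖ + α * ‖g‖ + ‖e‖ := by
    have : w = x - α • g - e := by rw [he]; abel
    calc ‖w‖ = ‖x - α • g - e‖ := by rw [← this]
      _ ≤ ‖x‖ + ‖α • g‖ + ‖e‖ := (norm_sub_le _ _).trans (by gcongr; exact norm_sub_le _ _)
      _ = _ := by rw [norm_smul, Real.norm_of_nonneg hα0.le]
  have h3 : 0 ≤ α * lam * lq q w := mul_nonneg (by positivity) (lq_nonneg _ _)
  have h4 : ‖e‖ ^ 2 ≤ (α * ‖g‖) ^ 2 + 2 * (α * lam * lq q x) := by linarith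
  have h5 : α * lam * lq q x ≤ τ * lam * lq q x := by
    have := lq_nonneg q x
    gcongr
  have h6 : (α * ‖g‖) ^ 2 ≤ τ ^ 2 * ‖g‖ ^ 2 := by
    rw [mul_pow]
    gcongr
  have h7 : ‖w‖ ^ 2 ≤ (‖x‖ + α * ‖g‖ + ‖e‖) ^ 2 := by gcongr
  have h8 : (‖x‖ + α * ‖g‖ + ‖e‖) ^ 2 ≤ 5 * ‖x‖ ^ 2 + 5 / 2 * (α * ‖g‖) ^ 2 + 5 / 2 * ‖e‖ ^ 2 := by
    nlinarith [sq_nonneg (2 * ‖x‖ - α * ‖g‖), sq_nonneg (2 * ‖x‖ - ‖e‖),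
      sq_nonneg (α * ‖g‖ - ‖e‖)]
  linarith

variable {ι : Type*} [Finite ι] {f : Vec n → ℝ} {P : ι → Set (Vec n)} {A : ι → Vec n →L[ℝ] Vec n}

namespace PiecewiseAffineGradient

/-- Add the descent inequality to the comparison of `w` with `x` in the proximal problem. Bounds for
`t < 1` suffice, so `w` itself may lie on the boundary of the ball defining `sigma0`. -/
theorem objF_prox_le (h : PiecewiseAffineGradient f P A) {q lam α σ L : ℝ} (hα0 : 0 < α)
    (hαL : α * (σ + L) ≤ 1) {x w : Vec n}
    (hw : w ∈ prox (fun z => α * lam * lq q z) (x - α • gradient f x))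
    (hL : ∀ t ∈ Set.Ico (0 : ℝ) 1, ∀ I, (interior (P I)).Nonempty → x + t • (w - x) ∈ P I →
      ‖A I‖ ≤ L) :
    objF f q lam w ≤ objF f q lam x - σ / 2 * ‖w - x‖ ^ 2 := by
  have h1 := h.quadratic_upper (a := x) (b := w) (c := L) fun t ht I hI hz => by
    calc inner ℝ (A I (w - x)) (w - x) ≤ ‖A I (w - x)‖ * ‖w - x‖ := real_inner_le_norm _ _
      _ ≤ (‖A I‖ * ‖w - x‖) * ‖w - x‖ := by gcongr; exact (A I).le_opNorm _
      _ ≤ (L * ‖w - x‖) * ‖w - x‖ := by gcongr; exact hL t ht I hI hz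
      _ = L * ‖w - x‖ ^ 2 := by ring
  have h2 := hw x
  have h3 : x - α • gradient f x - w = -(α • gradient f x + (w - x)) := by abel
  have h4 : x - α • gradient f x - x = -(α • gradient f x) := by abel
  simp only [h3, h4, norm_neg] at h2
  rw [norm_add_sq_real, real_inner_smul_left] at h2
  have h5 : α * (lam * lq q w + inner ℝ (gradient f x) (w - x) + σ / 2 * ‖w - x‖ ^ 2 +
      L / 2 * ‖w - x‖ ^ 2) ≤ α * (lam * lq q x) := by
    have : α * (σ + L) * ‖w - x‖ ^ 2 ≤ 1 * ‖w - x‖ ^ 2 := by gcongr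
    linarith
  have h6 := le_of_mul_le_mul_left h5 hα0
  simp only [objF]
  linarith

theorem genHessian_norm_le (h : PiecewiseAffineGradient f P A) {L : ℝ} (hL : ∀ I, ‖A I‖ ≤ L)
    {z : Vec n} {H : Matrix (Fin n) (Fin n) ℝ} (hH : H ∈ genHessian f z) :
    ‖Matrix.toEuclideanCLM (n := Fin n) (𝕜 := ℝ) H‖ ≤ L := by
  have h0 := gradient_zero_fun (n := n)
  have h1 := h.toEuclideanCLM_mem_convexHull (p := fun _ => 0) (z := z) (H := H)
    contDiffAt_const (by simpa using hH)
  rw [← mem_closedBall_zero_iff]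
  refine convexHull_min ?_ (convex_closedBall 0 L) h1
  rintro B ⟨I, -, -, rfl⟩
  rw [h0]
  simpa using hL I

theorem norm_le_sigma0 (h : PiecewiseAffineGradient f P A) {q lam τ : ℝ} {x0 z : Vec n}
    (hz : ‖z‖ ^ 2 < c0 f q lam τ x0) {I : ι} (hI : (interior (P I)).Nonempty) (hzI : z ∈ P I) :
    ‖A I‖ ≤ sigma0 f q lam τ x0 := by
  have h0 := gradient_zero_fun (n := n)
  obtain ⟨L, -, hL⟩ := exists_norm_le A
  refine le_csSup ⟨L, ?_⟩ ?_
  · rintro r ⟨x, -, H, hH, rfl⟩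
    exact h.genHessian_norm_le hL hH
  · refine ⟨z, hz, (Matrix.toEuclideanCLM (n := Fin n) (𝕜 := ℝ)).symm (A I), ?_, ?_⟩
    · have := h.mem_genHessian (p := fun _ => 0) (z := z) contDiffAt_const hI hzI
      rw [h0] at this
      simpa using this
    · congr 1
      exact ((Matrix.toEuclideanCLM (n := Fin n) (𝕜 := ℝ)).apply_symm_apply _).symm

end PiecewiseAffineGradient

theorem sigma0_nonneg {q lam τ : ℝ} (x0 : Vec n) : 0 ≤ sigma0 f q lam τ x0 := by
  refine Real.sSup_nonneg ?_
  rintro r ⟨x, -, H, -, rfl⟩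
  exact norm_nonneg _

theorem norm_sq_le_of_objF_le {μ q lam : ℝ} (hμ : 0 < μ) (hlam : 0 < lam)
    (hf : ∀ x, μ / 2 * ‖x‖ ^ 2 ≤ f x) {x x0 : Vec n} (hx : objF f q lam x ≤ objF f q lam x0) :
    ‖x‖ ^ 2 ≤ 2 * objF f q lam x0 / μ ∧ lam * lq q x ≤ objF f q lam x0 := by
  have h1 := hf x
  have h2 : 0 ≤ lam * lq q x := mul_nonneg hlam.le (lq_nonneg _ _)
  have h3 : 0 ≤ μ / 2 * ‖x‖ ^ 2 := by positivity
  simp only [objF] at hx ⊢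
  refine ⟨?_, by linarith⟩
  rw [le_div_iff₀ hμ]
  linarith

/-- Coercivity makes the level set bounded, so the real supremum is a genuine one rather than the
default value 0. -/
theorem le_c0 (hg : Continuous (gradient f)) {μ q lam τ : ℝ} (hμ : 0 < μ) (hlam : 0 < lam)
    (hτ : 0 < τ) (hf : ∀ x, μ / 2 * ‖x‖ ^ 2 ≤ f x) {x x0 : Vec n}
    (hx : objF f q lam x ≤ objF f q lam x0) :
    5 * (‖x‖ ^ 2 + τ ^ 2 * ‖gradient f x‖ ^ 2 + τ * lam * lq q x) ≤ c0 f q lam τ x0 := by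
  refine le_csSup ?_ ⟨x, hx, rfl⟩
  set R := objF f q lam x0
  obtain ⟨C, hC⟩ := (isCompact_closedBall (0 : Vec n)
    (Real.sqrt (2 * R / μ))).exists_bound_of_continuousOn hg.continuousOn
  refine ⟨5 * (2 * R / μ + τ ^ 2 * C ^ 2 + τ * R), ?_⟩
  rintro r ⟨z, hz, rfl⟩
  obtain ⟨h1, h2⟩ := norm_sq_le_of_objF_le hμ hlam hf hz
  have h3 := hC z (mem_closedBall_zero_iff.2 (Real.le_sqrt_of_sq_le h1))
  have h4 : τ * lam * lq q z ≤ τ * R := by rw [mul_assoc]; gcongr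
  gcongr

theorem norm_add_smul_sq_lt {x w : Vec n} {c t : ℝ} (hx : ‖x‖ ^ 2 < c) (hw : ‖w‖ ^ 2 ≤ c)
    (ht0 : 0 ≤ t) (ht1 : t < 1) : ‖x + t • (w - x)‖ ^ 2 < c := by
  have hc : 0 < c := lt_of_le_of_lt (sq_nonneg _) hx
  have h1 : ‖x‖ < √c := Real.lt_sqrt_of_sq_lt hx
  have h2 : ‖w‖ ≤ √c := Real.le_sqrt_of_sq_le hw
  have h3 : ‖x + t • (w - x)‖ ≤ (1 - t) * ‖x‖ + t * ‖w‖ := by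
    have : x + t • (w - x) = (1 - t) • x + t • w := by module
    rw [this]
    refine (norm_add_le _ _).trans ?_
    rw [norm_smul, norm_smul, Real.norm_of_nonneg ht0, Real.norm_of_nonneg (by linarith)]
  have h4 : ‖x + t • (w - x)‖ < √c := by nlinarith
  calc ‖x + t • (w - x)‖ ^ 2 < √c ^ 2 := by gcongr
    _ = c := Real.sq_sqrt hc.le

theorem PiecewiseAffineGradient.sufficientDecrease (h : PiecewiseAffineGradient f P A)
    {μ q lam σ τ γ α : ℝ} (hμ : 0 < μ) (hlam : 0 < lam) (hσ : 0 < σ) (hτ : 0 < τ)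
    (hf : ∀ x, μ / 2 * ‖x‖ ^ 2 ≤ f x) {x w : ℕ → Vec n} (hα0 : 0 < α)
    (hα : α ≤ min τ (1 / (σ + sigma0 f q lam τ (x 0)))) (hrun : IsPSNPRun f q lam σ γ α x w) :
    SufficientDecrease f q lam σ x w ∧ ∀ k, objF f q lam (x k) ≤ objF f q lam (x 0) := by
  have hs0 := sigma0_nonneg (f := f) (q := q) (lam := lam) (τ := τ) (x 0)
  have hατ : α ≤ τ := hα.trans (min_le_left _ _)
  have hα1 : α * (σ + sigma0 f q lam τ (x 0)) ≤ 1 :=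
    (le_div_iff₀ (by linarith)).1 (hα.trans (min_le_right _ _))
  have step : ∀ k, objF f q lam (x k) ≤ objF f q lam (x 0) →
      objF f q lam (w k) ≤ objF f q lam (x k) - σ / 2 * ‖w k - x k‖ ^ 2 := by
    intro k hk
    have hw := (hrun k).1
    have hc := le_c0 (τ := τ) h.continuous_gradient hμ hlam hτ hf hk
    have hwc := (norm_sq_le_of_mem_prox hα0 hατ hlam hw).trans hc
    have hlq := lq_nonneg q (x k)
    have h1 : 0 ≤ τ ^ 2 * ‖gradient f (x k)‖ ^ 2 := by positivity
    have h2 : 0 ≤ τ * lam * lq q (x k) := by positivity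
    -- The strict bound `‖x k‖ ^ 2 < c0` follows from the factor 5 when `x k ≠ 0`. If `x k = 0` and
    -- `c0` is not positive, then `w k = 0` too and nothing moves.
    rcases (sq_nonneg ‖x k‖).lt_or_eq with h3 | h3
    · exact h.objF_prox_le hα0 hα1 hw fun t ht I hI hz =>
        h.norm_le_sigma0 (norm_add_smul_sq_lt (by linarith) hwc ht.1 ht.2) hI hz
    · by_cases h4 : 0 < c0 f q lam τ (x 0)
      · exact h.objF_prox_le hα0 hα1 hw fun t ht I hI hz =>
          h.norm_le_sigma0 (norm_add_smul_sq_lt (by linarith) hwc ht.1 ht.2) hI hz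
      · have h5 : w k = 0 := by
          rw [← norm_eq_zero, ← sq_eq_zero_iff]
          exact le_antisymm (by linarith) (sq_nonneg _)
        have h6 : x k = 0 := by
          rw [← norm_eq_zero, ← sq_eq_zero_iff]
          exact h3.symm
        rw [h5, h6]
        simp
  have hall : ∀ k, objF f q lam (x k) ≤ objF f q lam (x 0) := by
    intro k
    induction k with
    | zero => exact le_rfl
    | succ k ih =>
      have h1 := step k ih
      have h2 := (hrun k).2.objF_le
      have h3 : 0 ≤ σ / 2 * ‖w k - x k‖ ^ 2 := by positivity
      have h4 : 0 ≤ σ / 2 * ‖x (k + 1) - w k‖ ^ 2 := by positivity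
      linarith
  exact ⟨fun k => step k (hall k), hall⟩

end

end PSNP

/-! ### Principal submatrices and the local model at the limit point -/

namespace PSNP

noncomputable section

variable {n : ℕ}

theorem principal_mulVec {S : Finset (Fin n)} (H : Matrix (Fin n) (Fin n) ℝ) {v : Vec n}
    (hv : ∀ i, i ∉ S → v i = 0) :
    (principal S H).mulVec (fun i => v i) =
      fun i : S => Matrix.toEuclideanCLM (n := Fin n) (𝕜 := ℝ) H v i := by
  ext i
  change ∑ j : S, H i j * v j = ∑ j, H i j * v j
  rw [Finset.sum_coe_sort S fun j => H i j * v j]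
  exact Finset.sum_subset (Finset.subset_univ S) fun j _ hj => by rw [hv j hj, mul_zero]

theorem inner_eq_sum_of_supported {S : Finset (Fin n)} (u : Vec n) {v : Vec n}
    (hv : ∀ i, i ∉ S → v i = 0) : inner ℝ u v = ∑ i ∈ S, u i * v i := by
  rw [PiLp.inner_apply, Finset.sum_subset (Finset.subset_univ S) (f := fun i => u i * v i)
    fun i _ hi => by rw [hv i hi, mul_zero]]
  exact Finset.sum_congr rfl fun i _ => mul_comm _ _

theorem inner_eq_zero_of_supported {S : Finset (Fin n)} {u v : Vec n}
    (hv : ∀ i, i ∉ S → v i = 0) (hu : ∀ i ∈ S, u i = 0) : inner ℝ u v = 0 := by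
  rw [inner_eq_sum_of_supported u hv]
  exact Finset.sum_eq_zero fun i hi => by rw [hu i hi, zero_mul]

theorem principal_mulVec_dotProduct {S : Finset (Fin n)} (H : Matrix (Fin n) (Fin n) ℝ)
    {v : Vec n} (hv : ∀ i, i ∉ S → v i = 0) :
    (principal S H).mulVec (fun i => v i) ⬝ᵥ (fun i : S => v i) =
      inner ℝ (Matrix.toEuclideanCLM (n := Fin n) (𝕜 := ℝ) H v) v := by
  rw [principal_mulVec H hv, inner_eq_sum_of_supported _ hv, ← Finset.sum_coe_sort S]
  rfl

/-- Lower bound for the quadratic forms of the generalized Hessian from `σ < σ_*`. -/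
theorem le_inner_of_lt_sigmaStar {f : Vec n → ℝ} {q lam σ : ℝ} {x : Vec n}
    (h : (σ : EReal) < sigmaStar f q lam x) {H : Matrix (Fin n) (Fin n) ℝ}
    (hH : H ∈ genHessian (objE f q lam (supp x)) x) {v : Vec n}
    (hv : ∀ i, i ∉ supp x → v i = 0) :
    2 * σ * ‖v‖ ^ 2 ≤ inner ℝ (Matrix.toEuclideanCLM (n := Fin n) (𝕜 := ℝ) H v) v := by
  by_cases h0 : v = 0
  · simp [h0]
  have hpos : 0 < ‖v‖ := norm_pos_iff.2 h0
  set u := ‖v‖⁻¹ • v with hu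
  have hun : ‖u‖ = 1 := by
    rw [hu, norm_smul, norm_inv, norm_norm, inv_mul_cancel₀ hpos.ne']
  have hus : ∀ i, i ∉ supp x → u i = 0 := fun i hi => by simp [hu, hv i hi]
  have h1 : sigmaStar f q lam x ≤
      ((1 / 2 * inner ℝ (Matrix.toEuclideanCLM (n := Fin n) (𝕜 := ℝ) H u) u : ℝ) : EReal) := by
    refine sInf_le ⟨principal (supp x) H, ⟨H, hH, rfl⟩,
      WithLp.toLp 2 (fun i : supp x => u i), ?_, ?_⟩
    · have h2 := inner_eq_sum_of_supported u hus
      rw [real_inner_self_eq_norm_sq, hun] at h2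
      have h3 : ‖(WithLp.toLp 2 (fun i : supp x => u i) : EuclideanSpace ℝ (supp x))‖ ^ 2 = 1 := by
        rw [EuclideanSpace.real_norm_sq_eq, Finset.sum_coe_sort (supp x) fun i => u i ^ 2]
        simp only [sq]
        linarith
      exact (pow_eq_one_iff_of_nonneg (norm_nonneg _) two_ne_zero).1 h3
    · rw [← principal_mulVec_dotProduct H hus]
  have h2 := EReal.coe_lt_coe_iff.1 (h.trans_le h1)
  have h3 : v = ‖v‖ • u := by rw [hu, smul_smul, mul_inv_cancel₀ hpos.ne', one_smul]
  have h4 : inner ℝ (Matrix.toEuclideanCLM (n := Fin n) (𝕜 := ℝ) H v) v =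
      ‖v‖ ^ 2 * inner ℝ (Matrix.toEuclideanCLM (n := Fin n) (𝕜 := ℝ) H u) u := by
    conv_lhs => rw [h3]
    rw [map_smul, real_inner_smul_left, real_inner_smul_right]
    ring
  rw [h4]
  nlinarith [sq_pos_of_pos hpos]

/-- The Newton equations are solvable if the quadratic form is positive definite on the vectors
supported in `supp w`. -/
theorem exists_isNewtonDir {f : Vec n → ℝ} {q lam c : ℝ} {w : Vec n} (hc : 0 < c)
    {H : Matrix (Fin n) (Fin n) ℝ} (hpos : ∀ v : Vec n, (∀ i, i ∉ supp w → v i = 0) →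
      c * ‖v‖ ^ 2 ≤ inner ℝ (Matrix.toEuclideanCLM (n := Fin n) (𝕜 := ℝ) H v) v) :
    ∃ d, IsNewtonDir f q lam w (principal (supp w) H) d := by
  let ext : (supp w → ℝ) → Vec n := fun u =>
    WithLp.toLp 2 fun i => if h : i ∈ supp w then u ⟨i, h⟩ else 0
  have hext : ∀ u, (fun i : supp w => ext u i) = u := fun u => by
    ext i
    simp [ext]
  have hext0 : ∀ u i, i ∉ supp w → ext u i = 0 := fun u i hi => by
    simp [ext, hi]
  have hinj : Function.Injective (Matrix.mulVecLin (principal (supp w) H)) := by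
    rw [← LinearMap.ker_eq_bot, LinearMap.ker_eq_bot']
    intro u hu
    rw [Matrix.mulVecLin_apply] at hu
    have h1 := principal_mulVec_dotProduct H (hext0 u)
    rw [hext, hu, zero_dotProduct] at h1
    have h2 := hpos (ext u) (hext0 u)
    rw [← h1] at h2
    have h3 : ext u = 0 := by
      rw [← norm_eq_zero, ← sq_eq_zero_iff]
      exact le_antisymm (by nlinarith) (sq_nonneg _)
    rw [← hext u, h3]
    rfl
  obtain ⟨u, hu⟩ := LinearMap.injective_iff_surjective.1 hinj
    (fun i : supp w => gradient (objE f q lam (supp w)) w i)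
  refine ⟨ext u, ?_, hext0 u⟩
  rw [hext]
  exact hu

variable {ι : Type*} {f p : Vec n → ℝ} {P : ι → Set (Vec n)} {A : ι → Vec n →L[ℝ] Vec n}

/-- Quantitative regularity of `f + p` on the ball of radius `ρ` around `xs`: near `xs` only the
cells through `xs` matter, the Hessians are uniformly positive definite on the vectors supported
in `S`, the second derivative of `p` is Lipschitz, and the gradient is Lipschitz at `xs`. -/
structure LocalModel (f p : Vec n → ℝ) (P : ι → Set (Vec n)) (A : ι → Vec n →L[ℝ] Vec n)
    (S : Finset (Fin n)) (xs : Vec n) (c K L ρ : ℝ) : Prop where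
  smooth : ∀ z ∈ Metric.ball xs ρ, ContDiffAt ℝ 3 p z
  cell : ∀ z ∈ Metric.ball xs ρ, ∀ I, z ∈ P I → xs ∈ P I
  pos : ∀ z ∈ Metric.ball xs ρ, ∀ I, (interior (P I)).Nonempty → z ∈ P I → ∀ v : Vec n,
    (∀ i, i ∉ S → v i = 0) → c * ‖v‖ ^ 2 ≤ inner ℝ ((A I + fderiv ℝ (gradient p) z) v) v
  lip : ∀ z ∈ Metric.ball xs ρ, ∀ z' ∈ Metric.ball xs ρ,
    ‖fderiv ℝ (gradient p) z - fderiv ℝ (gradient p) z'‖ ≤ K * ‖z - z'‖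
  grad_lip : ∀ z ∈ Metric.ball xs ρ,
    ‖(gradient f z + gradient p z) - (gradient f xs + gradient p xs)‖ ≤ L * ‖z - xs‖

/-- Near `xs` no new cells appear, so only `D∇p` varies; by continuity its change is absorbed by the
margin `c' - c`. -/
theorem PiecewiseAffineGradient.exists_localModel [Finite ι] (h : PiecewiseAffineGradient f P A)
    {S : Finset (Fin n)} {xs : Vec n} (hp : ContDiffAt ℝ 3 p xs) {c c' : ℝ} (hc : c < c')
    (hpos : ∀ I, (interior (P I)).Nonempty → xs ∈ P I → ∀ v : Vec n, (∀ i, i ∉ S → v i = 0) →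
      c' * ‖v‖ ^ 2 ≤ inner ℝ ((A I + fderiv ℝ (gradient p) xs) v) v) :
    ∃ K L ρ, 0 ≤ K ∧ 0 ≤ L ∧ 0 < ρ ∧ LocalModel f p P A S xs c K L ρ := by
  obtain ⟨K, t, ht, hK⟩ := (contDiffAt_fderiv_gradient hp).exists_lipschitzOnWith
  obtain ⟨K', t', ht', hK'⟩ := ((contDiffAt_gradient hp).of_le
    (by norm_num : (1 : WithTop ℕ∞) ≤ 2)).exists_lipschitzOnWith
  obtain ⟨L, hL0, hL⟩ := exists_norm_le A
  have hcont := (contDiffAt_fderiv_gradient hp).continuousAt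
  have hD : ∀ᶠ z in 𝓝 xs, ‖fderiv ℝ (gradient p) z - fderiv ℝ (gradient p) xs‖ < c' - c := by
    have := hcont.eventually (Metric.ball_mem_nhds _ (sub_pos.2 hc))
    simpa [dist_eq_norm] using this
  have hall := ((eventually_contDiffAt hp).and (h.eventually_mem xs)).and ((hD.and ht).and
    (Filter.Eventually.and ht' (h.eventually_norm_gradient_sub_le hL xs)))
  obtain ⟨ρ, hρ, hball⟩ := Metric.eventually_nhds_iff_ball.1 hall
  refine ⟨K, L + K', ρ, K.2, add_nonneg hL0 K'.2, hρ, ?_⟩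
  constructor
  · exact fun z hz => (hball z hz).1.1
  · exact fun z hz => (hball z hz).1.2
  · intro z hz I hI hzI v hv
    have h1 := hpos I hI ((hball z hz).1.2 I hzI) v hv
    have h2 := (hball z hz).2.1.1
    have h3 : (A I + fderiv ℝ (gradient p) z) v = (A I + fderiv ℝ (gradient p) xs) v +
        (fderiv ℝ (gradient p) z - fderiv ℝ (gradient p) xs) v := by
      simp only [add_apply, sub_apply]
      abel
    rw [h3, inner_add_left]
    have h4 : |inner ℝ ((fderiv ℝ (gradient p) z - fderiv ℝ (gradient p) xs) v) v| ≤
        (c' - c) * ‖v‖ ^ 2 := by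
      calc _ ≤ ‖(fderiv ℝ (gradient p) z - fderiv ℝ (gradient p) xs) v‖ * ‖v‖ :=
            abs_real_inner_le_norm _ _
        _ ≤ ((c' - c) * ‖v‖) * ‖v‖ := by
            gcongr
            exact (ContinuousLinearMap.le_opNorm _ _).trans (by gcongr)
        _ = _ := by ring
    have := (abs_le.1 h4).1
    linarith
  · intro z hz z' hz'
    have := hK.dist_le_mul z (hball z hz).2.1.2 z' (hball z' hz').2.1.2
    simpa [dist_eq_norm] using this
  · intro z hz
    have h1 := hK'.dist_le_mul z (hball z hz).2.2.1 xs (hball xs (Metric.mem_ball_self hρ)).2.2.1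
    rw [dist_eq_norm, dist_eq_norm] at h1
    have h2 := (hball z hz).2.2.2
    rw [add_sub_add_comm, add_mul]
    exact (norm_add_le _ _).trans (add_le_add h2 h1)

namespace LocalModel

variable {S : Finset (Fin n)} {xs : Vec n} {c K L ρ : ℝ}

theorem quadratic_lower [Finite ι] (M : LocalModel f p P A S xs c K L ρ)
    (h : PiecewiseAffineGradient f P A) {a b : Vec n} (ha : a ∈ Metric.ball xs ρ)
    (hb : b ∈ Metric.ball xs ρ) (hab : ∀ i, i ∉ S → (b - a) i = 0) :
    inner ℝ (gradient f a + gradient p a) (b - a) + c * ‖b - a‖ ^ 2 ≤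
        inner ℝ (gradient f b + gradient p b) (b - a) ∧
      f a + p a + inner ℝ (gradient f a + gradient p a) (b - a) + c / 2 * ‖b - a‖ ^ 2 ≤
        f b + p b := by
  have hseg : ∀ t ∈ Set.Icc (0 : ℝ) 1, a + t • (b - a) ∈ Metric.ball xs ρ := fun t ht =>
    (convex_ball xs ρ).add_smul_sub_mem ha hb ht
  exact h.quadratic_lower (fun t ht => M.smooth _ (hseg t ht)) fun t ht I hI hz =>
    M.pos _ (hseg t (Set.Ico_subset_Icc_self ht)) I hI hz _ hab

theorem norm_gradient_sub_sub_le (M : LocalModel f p P A S xs c K L ρ) (hK : 0 ≤ K) {w : Vec n}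
    (hw : w ∈ Metric.ball xs ρ) :
    ‖gradient p w - gradient p xs - fderiv ℝ (gradient p) w (w - xs)‖ ≤ 2 * K * ‖w - xs‖ ^ 2 := by
  set r := ‖w - xs‖ with hr
  have hwr : w ∈ Metric.closedBall xs r := by simp [dist_eq_norm, hr]
  have hsub : Metric.closedBall xs r ⊆ Metric.ball xs ρ :=
    Metric.closedBall_subset_ball (by simpa [dist_eq_norm, hr] using hw)
  have h1 := (convex_closedBall xs r).norm_image_sub_le_of_norm_hasFDerivWithin_le'
    (f := gradient p) (f' := fderiv ℝ (gradient p)) (φ := fderiv ℝ (gradient p) w)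
    -- Two points of the ball of radius `r` are at distance at most `2 * r`.
    (C := 2 * K * r) (x := xs) (y := w) (fun z hz => ?_) (fun z hz => ?_)
    (Metric.mem_closedBall_self (norm_nonneg _)) hwr
  · calc _ ≤ 2 * K * r * ‖w - xs‖ := h1
      _ = _ := by rw [← hr]; ring
  · exact ((contDiffAt_gradient (M.smooth z (hsub hz))).differentiableAt
      (by norm_num)).hasFDerivAt.hasFDerivWithinAt
  · refine (M.lip z (hsub hz) w hw).trans ?_
    have h2 : ‖z - w‖ ≤ r + r := by
      rw [← dist_eq_norm]
      refine (dist_triangle_right z w xs).trans (add_le_add hz ?_)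
      simp [dist_eq_norm, hr]
    nlinarith

/-- On each cell through `w` the operator `A I` maps `w - xs` exactly to `∇f(w) - ∇f(xs)`, so the
error comes from `p` alone. The identity behind the first bound and the inequality of the second are
convex conditions on the operator, hence pass to convex hulls. -/
theorem genHessian_bounds [Finite ι] (M : LocalModel f p P A S xs c K L ρ)
    (h : PiecewiseAffineGradient f P A) (hK : 0 ≤ K) {w : Vec n}
    (hw : w ∈ Metric.ball xs ρ) {H : Matrix (Fin n) (Fin n) ℝ}
    (hH : H ∈ genHessian (fun x => f x + p x) w) :
    ‖Matrix.toEuclideanCLM (n := Fin n) (𝕜 := ℝ) H (w - xs) -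
        ((gradient f w + gradient p w) - (gradient f xs + gradient p xs))‖ ≤
        2 * K * ‖w - xs‖ ^ 2 ∧
      ∀ v : Vec n, (∀ i, i ∉ S → v i = 0) →
        c * ‖v‖ ^ 2 ≤ inner ℝ (Matrix.toEuclideanCLM (n := Fin n) (𝕜 := ℝ) H v) v := by
  have hmem := h.toEuclideanCLM_mem_convexHull (M.smooth w hw) hH
  set B := Matrix.toEuclideanCLM (n := Fin n) (𝕜 := ℝ) H
  constructor
  · have hconv : Convex ℝ {B : Vec n →L[ℝ] Vec n | B (w - xs) =
        gradient f w - gradient f xs + fderiv ℝ (gradient p) w (w - xs)} := by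
      intro B₁ h₁ B₂ h₂ s t _ _ hst
      simp only [Set.mem_ofPred_eq] at h₁ h₂
      simp only [Set.mem_ofPred_eq, add_apply, smul_apply, h₁, h₂]
      rw [← add_smul, hst, one_smul]
    have h1 := convexHull_min (s := {B | ∃ I, (interior (P I)).Nonempty ∧ w ∈ P I ∧
        B = A I + fderiv ℝ (gradient p) w}) (fun B' hB' => ?_) hconv hmem
    · simp only [Set.mem_ofPred_eq] at h1
      rw [h1, ← norm_neg]
      refine le_trans (le_of_eq ?_) (M.norm_gradient_sub_sub_le hK hw)
      congr 1
      abel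
    · obtain ⟨I, -, hI, rfl⟩ := hB'
      simp only [Set.mem_ofPred_eq, add_apply]
      rw [h.gradient_sub I w hI xs (M.cell w hw I hI)]
  · intro v hv
    have hconv : Convex ℝ {B : Vec n →L[ℝ] Vec n | c * ‖v‖ ^ 2 ≤ inner ℝ (B v) v} := by
      intro B₁ h₁ B₂ h₂ s t hs ht hst
      simp only [Set.mem_ofPred_eq] at h₁ h₂
      simp only [Set.mem_ofPred_eq, add_apply, smul_apply, inner_add_left, real_inner_smul_left]
      calc c * ‖v‖ ^ 2 = s * (c * ‖v‖ ^ 2) + t * (c * ‖v‖ ^ 2) := by rw [← add_mul, hst, one_mul]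
        _ ≤ _ := by gcongr
    refine convexHull_min (fun B' hB' => ?_) hconv hmem
    obtain ⟨I, hI1, hI, rfl⟩ := hB'
    exact M.pos w hw I hI1 hI v hv

end LocalModel

end

end PSNP

/-! ### Newton and proximal estimates, quadratic growth, isolation -/

namespace PSNP

noncomputable section

variable {n : ℕ} {ι : Type*} [Finite ι] {f : Vec n → ℝ} {P : ι → Set (Vec n)}
  {A : ι → Vec n →L[ℝ] Vec n} {q lam : ℝ} {S : Finset (Fin n)} {xs : Vec n} {c K L ρ : ℝ}

theorem objF_eq_of_supported {z : Vec n} (hz : ∀ i, i ∉ S → z i = 0) :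
    objF f q lam z = f z + lam * lqOn q S z := by
  rw [objF, lq_eq_lqOn hz]

theorem not_mem_supp_iff {z : Vec n} {i : Fin n} : i ∉ supp z ↔ z i = 0 := by simp [mem_supp]

namespace LocalModel

/-- One Newton phase started close to `xs` takes the full step and is quadratically good. -/
theorem exists_newtonPhase_bound
    (M : LocalModel f (fun z => lam * lqOn q S z) P A S xs c K L ρ)
    (h : PiecewiseAffineGradient f P A) (hK : 0 ≤ K) (hL : 0 ≤ L) (hρ : 0 < ρ) {σ γ : ℝ}
    (hσ : 0 < σ) (hc : σ < c) (hS : ∀ i, i ∉ S → xs i = 0)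
    (hg : ∀ i ∈ S, (gradient f xs + gradient (fun z => lam * lqOn q S z) xs) i = 0) :
    ∃ C δ, 0 ≤ C ∧ 0 < δ ∧ ∀ w x', ‖w - xs‖ < δ → supp w = S → NewtonPhase f q lam σ γ w x' →
      ‖x' - xs‖ ≤ C * ‖w - xs‖ ^ 2 := by
  set p : Vec n → ℝ := fun z => lam * lqOn q S z with hp
  have hc0 : 0 < c := hσ.trans hc
  set C := 2 * K / c with hC
  have hC0 : 0 ≤ C := by positivity
  -- The three bounds keep `w` well inside the ball, make the Newton error at most half of `‖w -
  -- xs‖`, and keep the gradient term of the line search below the margin `c - σ`.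
  set δ := min (ρ / 2) (min (1 / (2 * (C + 1))) ((c - σ) / (4 * (L * C + 1)))) with hδ
  have hδ0 : 0 < δ := by
    have : 0 < c - σ := by linarith
    simp only [hδ, lt_min_iff]
    refine ⟨by positivity, by positivity, by positivity⟩
  have hδ1 : δ ≤ ρ / 2 := min_le_left _ _
  have hδ2 : C * δ ≤ 1 / 2 := by
    have h1 : δ ≤ 1 / (2 * (C + 1)) := (min_le_right _ _).trans (min_le_left _ _)
    rw [le_div_iff₀ (by positivity)] at h1
    linarith
  have hδ3 : 4 * (L * C) * δ ≤ c - σ := by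
    have h1 : δ ≤ (c - σ) / (4 * (L * C + 1)) := (min_le_right _ _).trans (min_le_right _ _)
    rw [le_div_iff₀ (by positivity)] at h1
    linarith
  refine ⟨C, δ, hC0, hδ0, fun w x' hw hwS hN => ?_⟩
  have hwb : w ∈ Metric.ball xs ρ := by rw [mem_ball_iff_norm]; linarith
  have hw0 : ∀ i, i ∉ S → w i = 0 := fun i hi => not_mem_supp_iff.1 (hwS ▸ hi)
  have main : ∀ H ∈ genHessian (objE f q lam (supp w)) w, ∀ d,
      IsNewtonDir f q lam w (principal (supp w) H) d →
      ‖w - d - xs‖ ≤ C * ‖w - xs‖ ^ 2 ∧ Admissible f q lam σ γ w d 0 := by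
    intro H hH d hd
    have hd0 : ∀ i, i ∉ S → d i = 0 := fun i hi => hd.2 i (hwS ▸ hi)
    have hdS : ∀ i ∈ S, Matrix.toEuclideanCLM (n := Fin n) (𝕜 := ℝ) H d i =
        gradient (objE f q lam S) w i := by
      intro i hi
      have h1 := hd.1
      rw [principal_mulVec H hd.2] at h1
      have h2 := congrFun h1 ⟨i, hwS ▸ hi⟩
      simp only at h2
      rw [h2, hwS]
    rw [hwS] at hH
    have hgw : gradient (objE f q lam S) w = gradient f w + gradient p w :=
      gradient_add' h.differentiable.differentiableAt
        ((M.smooth w hwb).differentiableAt (by norm_num))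
    rw [hgw] at hdS
    obtain ⟨hb1, hb2⟩ := M.genHessian_bounds h hK hwb (H := H) hH
    set B := Matrix.toEuclideanCLM (n := Fin n) (𝕜 := ℝ) H
    set e := w - d - xs with he
    have he0 : ∀ i, i ∉ S → e i = 0 := fun i hi => by simp [he, hw0 i hi, hd0 i hi, hS i hi]
    -- On `S` the Newton equation replaces `B d` by the gradient at `w`, and the gradient at `xs`
    -- vanishes, so `B e` is the linearization residual there.
    have hBe : inner ℝ (B e) e = inner ℝ (B (w - xs) -
        ((gradient f w + gradient p w) - (gradient f xs + gradient p xs))) e := by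
      rw [← sub_eq_zero, ← inner_sub_left]
      refine inner_eq_zero_of_supported he0 fun i hi => ?_
      have h1 : B e = B (w - xs) - B d := by rw [← map_sub]; congr 1; rw [he]; abel
      rw [h1]
      have h2 := hdS i hi
      have h3 := hg i hi
      simp only [PiLp.sub_apply, PiLp.add_apply] at h2 h3 ⊢
      linarith
    have he1 : ‖e‖ ≤ C * ‖w - xs‖ ^ 2 := by
      have h1 := hb2 e he0
      rw [hBe] at h1
      have h2 := h1.trans ((real_inner_le_norm _ _).trans
        (mul_le_mul_of_nonneg_right hb1 (norm_nonneg e)))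
      rcases (norm_nonneg e).eq_or_lt with h3 | h3
      · rw [← h3]; positivity
      · have h4 : c * ‖e‖ ≤ 2 * K * ‖w - xs‖ ^ 2 := by
          refine le_of_mul_le_mul_right ?_ h3
          linarith
        rw [hC, div_mul_eq_mul_div, le_div_iff₀ hc0]
        linarith
    refine ⟨he1, ?_⟩
    set r := ‖w - xs‖ with hr
    have hr0 : 0 ≤ r := norm_nonneg _
    have he2 : ‖e‖ ≤ r / 2 := by nlinarith
    have hwe : w - xs = d + e := by rw [he]; abel
    have hrd : r ≤ 2 * ‖d‖ := by
      have : r ≤ ‖d‖ + ‖e‖ := by rw [hr, hwe]; exact norm_add_le _ _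
      linarith
    have hzb : w - d ∈ Metric.ball xs ρ := by
      rw [mem_ball_iff_norm, ← he]
      linarith
    have hwd : w - (w - d) = d := by abel
    -- Expanding around the trial point `w - d` is favourable: its distance to `xs` is quadratic in
    -- `r`, so its gradient on `S` is too.
    have h1 := (M.quadratic_lower h hzb hwb (by rw [hwd]; exact hd0)).2
    rw [hwd] at h1
    have h2 := M.grad_lip _ hzb
    rw [← he] at h2
    have h3 : inner ℝ (gradient f (w - d) + gradient p (w - d)) d =
        inner ℝ ((gradient f (w - d) + gradient p (w - d)) -
          (gradient f xs + gradient p xs)) d := by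
      rw [inner_sub_left, inner_eq_zero_of_supported hd0 hg, sub_zero]
    have h4 : -(L * (C * r ^ 2) * ‖d‖) ≤
        inner ℝ (gradient f (w - d) + gradient p (w - d)) d := by
      rw [h3]
      refine (neg_le_neg ?_).trans (abs_le.1 (abs_real_inner_le_norm _ d)).1
      gcongr
      exact h2.trans (by gcongr)
    have h5 : L * (C * r ^ 2) * ‖d‖ ≤ (c - σ) / 2 * ‖d‖ ^ 2 := by
      have h6 : r ^ 2 ≤ δ * (2 * ‖d‖) := by nlinarith [norm_nonneg d]
      calc L * (C * r ^ 2) * ‖d‖ ≤ L * (C * (δ * (2 * ‖d‖))) * ‖d‖ := by gcongr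
        _ = (4 * (L * C) * δ) / 2 * ‖d‖ ^ 2 := by ring
        _ ≤ _ := by gcongr
    rw [Admissible, pow_zero, one_smul, objF_eq_of_supported hw0,
      objF_eq_of_supported (S := S) (z := w - d) fun i hi => by simp [hw0 i hi, hd0 i hi]]
    simp only [hp] at h1
    linarith
  obtain ⟨_, ⟨H, hH, rfl⟩, hcase⟩ := hN
  rcases hcase with ⟨d, hd, s, hs, rfl⟩ | ⟨d, hd, hs, -⟩ | ⟨hno, -⟩
  · obtain ⟨h1, h2⟩ := main H hH d hd
    have hs0 : s = 0 := Nat.le_zero.1 (hs.2 h2)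
    rw [hs0, pow_zero, one_smul]
    exact h1
  · exact absurd (main H hH d hd).2 (hs 0)
  · refine absurd (exists_isNewtonDir hc0 fun v hv => ?_) hno
    have hH' := hH
    rw [hwS] at hH'
    exact (M.genHessian_bounds h hK hwb hH').2 v fun i hi => hv i (hwS ▸ hi)

/-- Convexity on the support gives `F(x) - L‖x - xs‖² ≤ F(xs) ≤ F(w)`. Together with the decrease
this bounds `‖w - x‖` by a multiple of `‖x - xs‖`, without any continuity of the proximal map. -/
theorem norm_prox_sub_sq_le
    (M : LocalModel f (fun z => lam * lqOn q S z) P A S xs c K L ρ)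
    (h : PiecewiseAffineGradient f P A) {σ : ℝ} (hρ : 0 < ρ)
    (hσ : 0 < σ) (hc : 0 < c) (hS : ∀ i, i ∉ S → xs i = 0)
    (hg : ∀ i ∈ S, (gradient f xs + gradient (fun z => lam * lqOn q S z) xs) i = 0)
    {x w : Vec n} (hx : x ∈ Metric.ball xs ρ) (hw : w ∈ Metric.ball xs ρ)
    (hxS : ∀ i, i ∉ S → x i = 0) (hwS : ∀ i, i ∉ S → w i = 0)
    (hdec : objF f q lam w ≤ objF f q lam x - σ / 2 * ‖w - x‖ ^ 2) :
    ‖w - xs‖ ^ 2 ≤ (4 * L / σ + 2) * ‖x - xs‖ ^ 2 := by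
  rw [objF_eq_of_supported hxS, objF_eq_of_supported hwS] at hdec
  have hxs := Metric.mem_ball_self (x := xs) hρ
  have hwd : ∀ i, i ∉ S → (w - xs) i = 0 := fun i hi => by simp [hwS i hi, hS i hi]
  have hxd : ∀ i, i ∉ S → (xs - x) i = 0 := fun i hi => by simp [hxS i hi, hS i hi]
  have h1 := (M.quadratic_lower h hxs hw hwd).2
  rw [inner_eq_zero_of_supported hwd hg] at h1
  have h2 := (M.quadratic_lower h hx hxs hxd).2
  have h3 : -(L * ‖x - xs‖ ^ 2) ≤
      inner ℝ (gradient f x + gradient (fun z => lam * lqOn q S z) x) (xs - x) := by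
    have h4 : inner ℝ (gradient f x + gradient (fun z => lam * lqOn q S z) x) (xs - x) =
        inner ℝ ((gradient f x + gradient (fun z => lam * lqOn q S z) x) -
          (gradient f xs + gradient (fun z => lam * lqOn q S z) xs)) (xs - x) := by
      rw [inner_sub_left, inner_eq_zero_of_supported hxd hg, sub_zero]
    rw [h4]
    refine (neg_le_neg ?_).trans (abs_le.1 (abs_real_inner_le_norm _ _)).1
    rw [norm_sub_rev xs x]
    calc _ ≤ (L * ‖x - xs‖) * ‖x - xs‖ := by gcongr; exact M.grad_lip x hx
      _ = _ := by ring
  have h5 : 0 ≤ c / 2 * ‖w - xs‖ ^ 2 := by positivity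
  have h6 : 0 ≤ c / 2 * ‖xs - x‖ ^ 2 := by positivity
  have h7 : σ / 2 * ‖w - x‖ ^ 2 ≤ L * ‖x - xs‖ ^ 2 := by linarith
  have h8 : ‖w - x‖ ^ 2 ≤ 2 * L / σ * ‖x - xs‖ ^ 2 := by
    rw [div_mul_eq_mul_div, le_div_iff₀ hσ]
    linarith
  have h9 : ‖w - xs‖ ≤ ‖w - x‖ + ‖x - xs‖ := norm_sub_le_norm_sub_add_norm_sub ..
  have h10 : ‖w - xs‖ ^ 2 ≤ (‖w - x‖ + ‖x - xs‖) ^ 2 := by gcongr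
  have h11 : 4 * L / σ = 2 * (2 * L / σ) := by ring
  rw [h11]
  nlinarith [sq_nonneg (‖w - x‖ - ‖x - xs‖)]

end LocalModel

/-- The restriction of a vector to the coordinates in `S`. -/
def restrict (S : Finset (Fin n)) (z : Vec n) : Vec n :=
  WithLp.toLp 2 fun i => if i ∈ S then z i else 0

theorem restrict_apply (S : Finset (Fin n)) (z : Vec n) (i : Fin n) :
    restrict S z i = if i ∈ S then z i else 0 := rfl

theorem norm_sub_restrict_le (S : Finset (Fin n)) (z : Vec n) :
    ‖z - restrict S z‖ ≤ ∑ i ∈ Sᶜ, |z i| := by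
  have h : z - restrict S z = ∑ i ∈ Sᶜ, EuclideanSpace.single i (z i) := by
    ext j
    by_cases hj : j ∈ S
    · simp [restrict_apply, hj, Pi.single_apply]
    · simp [restrict_apply, hj, Pi.single_apply]
  rw [h]
  refine (norm_sum_le _ _).trans (Finset.sum_le_sum fun i _ => ?_)
  simp

theorem norm_restrict_sub_le {S : Finset (Fin n)} {z xs : Vec n} (hS : ∀ i, i ∉ S → xs i = 0) :
    ‖restrict S z - xs‖ ≤ ‖z - xs‖ := by
  rw [EuclideanSpace.norm_eq, EuclideanSpace.norm_eq]
  refine Real.sqrt_le_sqrt (Finset.sum_le_sum fun i _ => ?_)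
  by_cases hi : i ∈ S
  · simp [restrict_apply, hi]
  · simp only [PiLp.sub_apply, restrict_apply, hi, hS i hi]
    simp
    positivity

theorem lqOn_restrict (q : ℝ) (S : Finset (Fin n)) (z : Vec n) :
    lqOn q S (restrict S z) = lqOn q S z :=
  Finset.sum_congr rfl fun i hi => by rw [restrict_apply, if_pos hi]

theorem PiecewiseAffineGradient.exists_lipschitz_near (h : PiecewiseAffineGradient f P A)
    (xs : Vec n) : ∃ N δ, 0 ≤ N ∧ 0 < δ ∧ (∀ z ∈ Metric.ball xs δ, ‖gradient f z‖ ≤ N) ∧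
      ∀ a ∈ Metric.ball xs δ, ∀ b ∈ Metric.ball xs δ, |f b - f a| ≤ N * ‖b - a‖ := by
  have h1 : ∀ᶠ z in 𝓝 xs, ‖gradient f z‖ < ‖gradient f xs‖ + 1 :=
    h.continuous_gradient.norm.continuousAt.eventually (gt_mem_nhds (by linarith))
  obtain ⟨δ, hδ, hb⟩ := Metric.eventually_nhds_iff_ball.1 h1
  refine ⟨‖gradient f xs‖ + 1, δ, by positivity, hδ, fun z hz => (hb z hz).le,
    fun a ha b hb' => ?_⟩
  refine (convex_ball xs δ).norm_image_sub_le_of_norm_fderiv_le (𝕜 := ℝ)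
    (fun z _ => h.differentiable z) (fun z hz => ?_) ha hb'
  rw [← toDual_gradient, LinearIsometryEquiv.norm_map]
  exact (hb z hz).le

theorem eventually_mul_sum_abs_le (hq1 : q < 1) (hlam : 0 < lam) (hS : ∀ i, i ∉ S → xs i = 0)
    (T : ℝ) : ∀ᶠ z in 𝓝 xs, ∀ i, i ∉ S → T * |z i| ≤ lam * absPow q (z i) := by
  rw [eventually_all]
  intro i
  by_cases hi : i ∈ S
  · exact Eventually.of_forall fun z hz => absurd hi hz
  have h1 : Tendsto (fun z : Vec n => z i) (𝓝 xs) (𝓝 0) := by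
    have := (contDiffAt_apply i xs).continuousAt.tendsto
    rwa [hS i hi] at this
  filter_upwards [h1.eventually (eventually_mul_abs_le_absPow hq1 (T / lam))] with z hz _
  calc T * |z i| = lam * (T / lam * |z i|) := by field_simp
    _ ≤ _ := by gcongr

/-- Move from `xs` to `restrict S z` by strong convexity, then to `z`, where the penalty on the new
entries outweighs the change of `f`. -/
theorem LocalModel.eventually_growth
    (M : LocalModel f (fun z => lam * lqOn q S z) P A S xs c K L ρ)
    (h : PiecewiseAffineGradient f P A) (hq1 : q < 1) (hlam : 0 < lam) (hρ : 0 < ρ) (hc : 0 < c)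
    (hS : ∀ i, i ∉ S → xs i = 0)
    (hg : ∀ i ∈ S, (gradient f xs + gradient (fun z => lam * lqOn q S z) xs) i = 0) :
    ∀ᶠ z in 𝓝 xs, objF f q lam xs + c / 4 * ‖z - xs‖ ^ 2 ≤ objF f q lam z := by
  obtain ⟨N, δ, hN, hδ, -, hlip⟩ := h.exists_lipschitz_near xs
  -- In the factor `N + c`, the term `N` pays for the variation of `f`. The term `c` pays for
  -- quadratic growth in the discarded part, whose norm is at most 1 by the ball of radius 1/2.
  filter_upwards [eventually_mul_sum_abs_le hq1 hlam hS (N + c), Metric.ball_mem_nhds xs hρ,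
    Metric.ball_mem_nhds xs hδ, Metric.ball_mem_nhds xs one_half_pos] with z h1 h2 h3 h4
  rw [mem_ball_iff_norm] at h4
  have hr := norm_restrict_sub_le (z := z) hS
  have hball : ∀ {ε}, z ∈ Metric.ball xs ε → restrict S z ∈ Metric.ball xs ε := fun hz => by
    rw [mem_ball_iff_norm] at hz ⊢
    exact hr.trans_lt hz
  have hrS : ∀ i, i ∉ S → (restrict S z - xs) i = 0 := fun i hi => by
    simp [restrict_apply, hi, hS i hi]
  have h5 := (M.quadratic_lower h (Metric.mem_ball_self hρ) (hball h2) hrS).2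
  rw [inner_eq_zero_of_supported hrS hg, lqOn_restrict] at h5
  have h6 := (abs_le.1 (hlip _ (hball h3) z h3)).1
  set β := ‖z - restrict S z‖ with hβ
  have h7 : (N + c) * β ≤ lam * lqOn q Sᶜ z := by
    calc (N + c) * β ≤ (N + c) * ∑ i ∈ Sᶜ, |z i| := by gcongr; exact norm_sub_restrict_le S z
      _ = ∑ i ∈ Sᶜ, (N + c) * |z i| := Finset.mul_sum ..
      _ ≤ ∑ i ∈ Sᶜ, lam * absPow q (z i) :=
          Finset.sum_le_sum fun i hi => h1 i (Finset.mem_compl.1 hi)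
      _ = _ := (Finset.mul_sum ..).symm
  have h8 : ‖z - xs‖ ≤ β + ‖restrict S z - xs‖ := norm_sub_le_norm_sub_add_norm_sub ..
  have h9 : ‖z - xs‖ ^ 2 ≤ (β + ‖restrict S z - xs‖) ^ 2 := by gcongr
  have hβ0 : 0 ≤ β := norm_nonneg _
  have h10 : β ≤ 1 := by
    have : z - restrict S z = (z - xs) - (restrict S z - xs) := by abel
    rw [hβ, this]
    exact (norm_sub_le _ _).trans (by linarith)
  have h11 : c / 2 * β ^ 2 ≤ c * β := by
    have h12 : β ^ 2 ≤ β := by nlinarith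
    have h13 : c * β ^ 2 ≤ c * β := by gcongr
    have h14 : 0 ≤ c * β ^ 2 := by positivity
    linarith
  have h15 : c / 4 * ‖z - xs‖ ^ 2 ≤ c / 2 * β ^ 2 + c / 2 * ‖restrict S z - xs‖ ^ 2 := by
    have h16 : ‖z - xs‖ ^ 2 ≤ 2 * β ^ 2 + 2 * ‖restrict S z - xs‖ ^ 2 := by
      nlinarith [sq_nonneg (β - ‖restrict S z - xs‖)]
    calc c / 4 * ‖z - xs‖ ^ 2 ≤ c / 4 * (2 * β ^ 2 + 2 * ‖restrict S z - xs‖ ^ 2) := by gcongr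
      _ = _ := by ring
  rw [objF_eq_of_supported hS, objF, lq_eq_add q S z]
  linarith

theorem isLocalMin_stationary (hf : Differentiable ℝ f) {z : Vec n}
    (hz : IsLocalMin (objF f q lam) z) {i : Fin n} (hi : z i ≠ 0) :
    gradient f z i + lam * (q * |z i| ^ q / z i) = 0 :=
  stationary_of_isLocalMin (hf z).hasGradientAt hz hi

/-- For `q > 0`, stationarity excludes small nonzero entries off the support, and strong
monotonicity on the support finishes. For `q = 0` the penalty is invisible to stationarity, so a
counting argument is used: each support carries at most one local minimizer. -/
theorem LocalModel.eventually_unique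
    (M : LocalModel f (fun z => lam * lqOn q (supp xs) z) P A (supp xs) xs c K L ρ)
    (h : PiecewiseAffineGradient f P A) {μ : ℝ} (hμ : 0 < μ)
    (hmono : ∀ x z, μ * ‖z - x‖ ^ 2 ≤ inner ℝ (gradient f z - gradient f x) (z - x))
    (hq0 : 0 ≤ q) (hq1 : q < 1) (hlam : 0 < lam) (hρ : 0 < ρ)
    (hc : 0 < c)
    (hg : ∀ i ∈ supp xs,
      (gradient f xs + gradient (fun z => lam * lqOn q (supp xs) z) xs) i = 0) :
    ∀ᶠ z in 𝓝 xs, IsLocalMin (objF f q lam) z → z = xs := by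
  rcases hq0.eq_or_lt with rfl | hqpos
  · have hinj : Set.InjOn supp {z : Vec n | IsLocalMin (objF f 0 lam) z} := by
      intro z hz z' hz' heq
      have hst : ∀ u, IsLocalMin (objF f 0 lam) u → ∀ i ∈ supp u, gradient f u i = 0 := by
        intro u hu i hi
        simpa using isLocalMin_stationary h.differentiable hu (mem_supp.1 hi)
      have h1 := hmono z' z
      rw [inner_eq_zero_of_supported (S := supp z)] at h1
      · have h2 : ‖z - z'‖ = 0 := by
          rw [← sq_eq_zero_iff]
          exact le_antisymm (by nlinarith) (sq_nonneg _)
        exact sub_eq_zero.1 (norm_eq_zero.1 h2)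
      · intro i hi
        have hi' : i ∉ supp z' := heq ▸ hi
        simp [not_mem_supp_iff.1 hi, not_mem_supp_iff.1 hi']
      · intro i hi
        simp [hst z hz i hi, hst z' hz' i (heq ▸ hi)]
    have hfin : {z : Vec n | IsLocalMin (objF f 0 lam) z}.Finite :=
      Set.Finite.of_finite_image (Set.toFinite _) hinj
    have hcl : IsClosed ({z : Vec n | IsLocalMin (objF f 0 lam) z} \ {xs}) :=
      (hfin.subset Set.sdiff_subset).isClosed
    filter_upwards [hcl.isOpen_compl.mem_nhds (by simp)] with z hz hmin
    by_contra hne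
    exact hz ⟨hmin, hne⟩
  · obtain ⟨N, δ, hN, hδ, hgN, -⟩ := h.exists_lipschitz_near xs
    have hS : ∀ i, i ∉ supp xs → xs i = 0 := fun i hi => not_mem_supp_iff.1 hi
    filter_upwards [eventually_mul_sum_abs_le (lam := lam * q) hq1 (by positivity) hS (N + 1),
      Metric.ball_mem_nhds xs hρ, Metric.ball_mem_nhds xs hδ,
      eventually_supp_eq one_pos xs] with z h1 h2 h3 h4 hmin
    have hzS : ∀ i, i ∉ supp xs → z i = 0 := by
      intro i hi
      by_contra hzi
      have h5 := isLocalMin_stationary h.differentiable hmin hzi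
      have h6 := h1 i hi
      have h7 : |gradient f z i| ≤ N := (PiLp.norm_apply_le _ i).trans (hgN z h3)
      -- Stationarity is multiplied by `z i`; the resulting penalty term exceeds `N * |z i|` near
      -- zero.
      have h8 : lam * q * absPow q (z i) = -(gradient f z i * z i) := by
        rw [absPow_of_ne hzi]
        field_simp at h5
        linarith
      have h9 : -(gradient f z i * z i) ≤ N * |z i| := by
        refine (neg_le_abs _).trans ?_
        rw [abs_mul]
        gcongr
      have h10 : 0 < |z i| := abs_pos.2 hzi
      linarith
    have hd : ∀ i, i ∉ supp xs → (z - xs) i = 0 := fun i hi => by simp [hzS i hi, hS i hi]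
    have hgz : ∀ i ∈ supp xs,
        (gradient f z + gradient (fun z => lam * lqOn q (supp xs) z) z) i = 0 := by
      intro i hi
      rw [PiLp.add_apply, gradient_lqOn_apply (fun j hj => mem_supp.1 (h4.1 hj)) hi]
      exact isLocalMin_stationary h.differentiable hmin (mem_supp.1 (h4.1 hi))
    have h5 := (M.quadratic_lower h (Metric.mem_ball_self hρ) h2 hd).1
    rw [inner_eq_zero_of_supported hd hg, inner_eq_zero_of_supported hd hgz] at h5
    have h6 : ‖z - xs‖ = 0 := by
      rw [← sq_eq_zero_iff]
      exact le_antisymm (by nlinarith) (sq_nonneg _)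
    exact sub_eq_zero.1 (norm_eq_zero.1 h6)

end

end PSNP

/-! ### Global convergence -/

namespace PSNP

noncomputable section

/-- A sequence that comes arbitrarily close to `p`, and near `p` eventually satisfies a quadratic
contraction estimate, converges quadratically to `p`. -/
theorem convergesQuadratically_of_local {n : ℕ} {x : ℕ → Vec n} {p : Vec n} {C δ : ℝ}
    (hC : 0 ≤ C) (hδ : 0 < δ) (hx : MapClusterPt p atTop x)
    (hstep : ∀ᶠ k in atTop, ‖x k - p‖ < δ → ‖x (k + 1) - p‖ ≤ C * ‖x k - p‖ ^ 2) :
    ConvergesQuadratically x p := by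
  obtain ⟨K, hK⟩ := eventually_atTop.1 hstep
  set ε := min δ (1 / (2 * (C + 1))) with hε
  have hε0 : 0 < ε := lt_min hδ (by positivity)
  have hεδ : ε ≤ δ := min_le_left _ _
  have hεC : C * ε ≤ 1 / 2 := by
    have h1 : ε ≤ 1 / (2 * (C + 1)) := min_le_right _ _
    rw [le_div_iff₀ (by positivity)] at h1
    linarith
  obtain ⟨k₀, hk₀, hxk₀⟩ : ∃ k ≥ K, ‖x k - p‖ < ε := by
    have := (hx.frequently (Metric.ball_mem_nhds p hε0)).and_eventually (eventually_ge_atTop K)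
    obtain ⟨k, hk1, hk2⟩ := this.exists
    exact ⟨k, hk2, by simpa [dist_eq_norm] using hk1⟩
  have key : ∀ j, ‖x (k₀ + j) - p‖ ≤ (1 / 2) ^ j * ‖x k₀ - p‖ := by
    intro j
    induction j with
    | zero => simp
    | succ j ih =>
      have h1 : ‖x (k₀ + j) - p‖ < ε := by
        refine lt_of_le_of_lt (ih.trans ?_) hxk₀
        exact mul_le_of_le_one_left (norm_nonneg _) (pow_le_one₀ (by norm_num) (by norm_num))
      have h2 := hK (k₀ + j) (by omega) (h1.trans_le hεδ)
      have h3 : C * ‖x (k₀ + j) - p‖ ≤ 1 / 2 := le_trans (by gcongr) hεC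
      rw [← add_assoc]
      calc ‖x (k₀ + j + 1) - p‖ ≤ (C * ‖x (k₀ + j) - p‖) * ‖x (k₀ + j) - p‖ := by
            rw [mul_assoc, ← sq]; exact h2
        _ ≤ 1 / 2 * ((1 / 2) ^ j * ‖x k₀ - p‖) := by gcongr
        _ = _ := by ring
  have hlim : Tendsto x atTop (𝓝 p) := by
    rw [← tendsto_add_atTop_iff_nat k₀, tendsto_iff_norm_sub_tendsto_zero]
    have h1 : Tendsto (fun j : ℕ => (1 / 2 : ℝ) ^ j * ‖x k₀ - p‖) atTop (𝓝 0) := by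
      simpa using (tendsto_pow_atTop_nhds_zero_of_lt_one (by norm_num : (0 : ℝ) ≤ 1 / 2)
        (by norm_num)).mul_const ‖x k₀ - p‖
    refine squeeze_zero (fun _ => norm_nonneg _) (fun j => ?_) h1
    rw [add_comm]
    exact key j
  refine ⟨hlim, C + 1, by positivity, ?_⟩
  have h1 : ∀ᶠ k in atTop, ‖x k - p‖ < δ := by
    have := hlim.eventually (Metric.ball_mem_nhds p hδ)
    simpa [dist_eq_norm] using this
  filter_upwards [h1, hstep] with k hk1 hk2
  refine (hk2 hk1).trans ?_
  gcongr
  linarith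

variable {n : ℕ} {ι : Type*} [Finite ι] {f : Vec n → ℝ} {P : ι → Set (Vec n)}
  {A : ι → Vec n →L[ℝ] Vec n} {q lam σ γ α : ℝ} {x w : ℕ → Vec n} {xs : Vec n}

/-- The decreases telescope: the values of `F` are nonincreasing and bounded below by 0, so
consecutive differences vanish and control both squared steps. -/
theorem tendsto_step_zero (hσ : 0 < σ) (hlam : 0 < lam) (hf0 : ∀ x, 0 ≤ f x)
    (hrun : IsPSNPRun f q lam σ γ α x w) (hdec : SufficientDecrease f q lam σ x w) :
    Tendsto (fun k => ‖w k - x k‖) atTop (𝓝 0) ∧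
      Tendsto (fun k => ‖x (k + 1) - w k‖) atTop (𝓝 0) := by
  have hstep : ∀ k, σ / 2 * (‖w k - x k‖ ^ 2 + ‖x (k + 1) - w k‖ ^ 2) ≤
      objF f q lam (x k) - objF f q lam (x (k + 1)) := by
    intro k
    have h1 := hdec k
    have h2 := (hrun k).2.objF_le
    linarith
  have hanti : Antitone fun k => objF f q lam (x k) := by
    refine antitone_nat_of_succ_le fun k => ?_
    have h1 := hstep k
    have h2 : 0 ≤ σ / 2 * (‖w k - x k‖ ^ 2 + ‖x (k + 1) - w k‖ ^ 2) := by positivity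
    linarith
  have hbdd : BddBelow (Set.range fun k => objF f q lam (x k)) := by
    refine ⟨0, ?_⟩
    rintro _ ⟨k, rfl⟩
    exact add_nonneg (hf0 _) (mul_nonneg hlam.le (lq_nonneg _ _))
  have hlim := tendsto_atTop_ciInf hanti hbdd
  have hdiff : Tendsto (fun k => 2 / σ * (objF f q lam (x k) - objF f q lam (x (k + 1)))) atTop
      (𝓝 0) := by
    simpa using (hlim.sub (hlim.comp (tendsto_add_atTop_nat 1))).const_mul (2 / σ)
  have hsq : ∀ k, ‖w k - x k‖ ^ 2 + ‖x (k + 1) - w k‖ ^ 2 ≤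
      2 / σ * (objF f q lam (x k) - objF f q lam (x (k + 1))) := by
    intro k
    have := hstep k
    rw [div_mul_eq_mul_div, le_div_iff₀ hσ]
    linarith
  have hsqrt : ∀ u : ℕ → ℝ, (∀ k, 0 ≤ u k) → Tendsto (fun k => u k ^ 2) atTop (𝓝 0) →
      Tendsto u atTop (𝓝 0) := by
    intro u hu h
    have := (Real.continuous_sqrt.tendsto 0).comp h
    rw [Real.sqrt_zero] at this
    exact this.congr fun k => Real.sqrt_sq (hu k)
  constructor
  · refine hsqrt _ (fun _ => norm_nonneg _) (squeeze_zero (fun _ => sq_nonneg _) (fun k => ?_) hdiff)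
    have := hsq k
    have h2 := sq_nonneg ‖x (k + 1) - w k‖
    linarith
  · refine hsqrt _ (fun _ => norm_nonneg _) (squeeze_zero (fun _ => sq_nonneg _) (fun k => ?_) hdiff)
    have := hsq k
    have h2 := sq_nonneg ‖w k - x k‖
    linarith

/-- The iterates stay in a bounded level set, so the arguments of the proximal map are bounded and
one threshold serves all `k`. -/
theorem exists_entry_lower_bound (h : PiecewiseAffineGradient f P A) {μ : ℝ} (hμ : 0 < μ)
    (hf : ∀ x, μ / 2 * ‖x‖ ^ 2 ≤ f x) (hq1 : q < 1) (hlam : 0 < lam) (hα : 0 < α)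
    (hrun : IsPSNPRun f q lam σ γ α x w)
    (hlev : ∀ k, objF f q lam (x k) ≤ objF f q lam (x 0)) :
    ∃ ν > 0, ∀ k i, w k i ≠ 0 → ν ≤ |w k i| := by
  set R := √(2 * objF f q lam (x 0) / μ)
  have hc : Continuous fun z => z - α • gradient f z :=
    continuous_id.sub (h.continuous_gradient.const_smul α)
  obtain ⟨B, hB⟩ := (isCompact_closedBall (0 : Vec n) R).exists_bound_of_continuousOn
    hc.continuousOn
  obtain ⟨ν, hν, hbound⟩ := exists_prox_lower_bound (n := n) hq1 (mul_pos hα hlam) B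
  refine ⟨ν, hν, fun k => hbound _ _ (hB _ ?_) (hrun k).1⟩
  exact mem_closedBall_zero_iff.2
    (Real.le_sqrt_of_sq_le (norm_sq_le_of_objF_le hμ hlam hf (hlev k)).1)

theorem continuousAt_lqOn {S : Finset (Fin n)} {z : Vec n} (hz : ∀ i ∈ S, z i ≠ 0) :
    ContinuousAt (lqOn q S) z := by
  have := (contDiffAt_lqOn (q := q) (lam := 1) hz).continuousAt
  simpa using this

/-- Accumulation points of the iterates are fixed points of the proximal gradient map. -/
theorem mem_prox_of_tendsto (h : PiecewiseAffineGradient f P A) {ν : ℝ} (hν : 0 < ν)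
    (hbound : ∀ k i, w k i ≠ 0 → ν ≤ |w k i|) (hrun : IsPSNPRun f q lam σ γ α x w)
    {φ : ℕ → ℕ} (hx : Tendsto (x ∘ φ) atTop (𝓝 xs)) (hw : Tendsto (w ∘ φ) atTop (𝓝 xs)) :
    xs ∈ prox (fun z => α * lam * lq q z) (xs - α • gradient f xs) := by
  intro z
  have hu : Tendsto (fun j => x (φ j) - α • gradient f (x (φ j))) atTop
      (𝓝 (xs - α • gradient f xs)) :=
    hx.sub (((h.continuous_gradient.tendsto xs).comp hx).const_smul α)
  -- The penalty may jump where an entry vanishes; eventual constancy of the support is what lets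
  -- its values converge.
  have hsupp : ∀ᶠ j in atTop, supp (w (φ j)) = supp xs := by
    filter_upwards [hw.eventually (eventually_supp_eq hν xs)] with j hj
    exact hj.2 (hbound _)
  have hlq : Tendsto (fun j => lq q (w (φ j))) atTop (𝓝 (lq q xs)) := by
    have h1 := (continuousAt_lqOn (q := q) (S := supp xs) (z := xs) fun i hi =>
      mem_supp.1 hi).tendsto.comp hw
    rw [← lq_eq_lqOn (S := supp xs) fun i hi => not_mem_supp_iff.1 hi] at h1
    refine h1.congr' ?_
    filter_upwards [hsupp] with j hj
    exact (lq_eq_lqOn fun i hi => not_mem_supp_iff.1 (hj ▸ hi)).symm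
  have hl := (((hu.sub hw).norm.pow 2).const_mul (1 / 2)).add (hlq.const_mul (α * lam))
  have hr := (((hu.sub (tendsto_const_nhds (x := z))).norm.pow 2).const_mul (1 / 2)).add
    (tendsto_const_nhds (x := α * lam * lq q z))
  exact le_of_tendsto_of_tendsto' hl hr fun j => (hrun (φ j)).1 z

theorem gradient_eq_zero_of_mem_prox {f : Vec n → ℝ} {q lam α : ℝ} {xs : Vec n} (hα : 0 < α)
    (hxs : xs ∈ prox (fun z => α * lam * lq q z) (xs - α • gradient f xs)) {i : Fin n}
    (hi : i ∈ supp xs) :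
    (gradient f xs + gradient (fun z => lam * lqOn q (supp xs) z) xs) i = 0 := by
  set u := xs - α • gradient f xs with hu
  have hg : HasGradientAt (fun z => 1 / 2 * ‖u - z‖ ^ 2) (α • gradient f xs) xs := by
    rw [hasGradientAt_iff_hasFDerivAt]
    have h1 := (((hasFDerivAt_id xs).const_sub u).norm_sq).const_mul (1 / 2)
    refine h1.congr_fderiv ?_
    ext v
    have h2 : u - xs = -(α • gradient f xs) := by rw [hu]; abel
    simp [h2]
  have hmin : IsLocalMin (fun z => 1 / 2 * ‖u - z‖ ^ 2 + α * lam * lq q z) xs :=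
    Eventually.of_forall fun z => hxs z
  have h1 := stationary_of_isLocalMin hg hmin (mem_supp.1 hi)
  rw [PiLp.add_apply, gradient_lqOn_apply (fun j hj => mem_supp.1 hj) hi]
  have h2 : α * (gradient f xs i + lam * (q * |xs i| ^ q / xs i)) = 0 := by
    rw [← h1]
    simp
    ring
  exact (mul_eq_zero.1 h2).resolve_left hα.ne'

/-- The convergence theorem for objectives with piecewise affine, strongly monotone gradient. -/
theorem PiecewiseAffineGradient.psnp_convergence (h : PiecewiseAffineGradient f P A) {μ τ : ℝ}
    (hμ : 0 < μ) (hf : ∀ x, μ / 2 * ‖x‖ ^ 2 ≤ f x)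
    (hmono : ∀ x z, μ * ‖z - x‖ ^ 2 ≤ inner ℝ (gradient f z - gradient f x) (z - x))
    (hq0 : 0 ≤ q) (hq1 : q < 1) (hlam : 0 < lam) (hσ : 0 < σ) (hτ : 0 < τ) (hα0 : 0 < α)
    (hα : α ≤ min τ (1 / (σ + sigma0 f q lam τ (x 0))))
    (hrun : IsPSNPRun f q lam σ γ α x w) (hxs : MapClusterPt xs atTop x)
    (hσs : (σ : EReal) < sigmaStar f q lam xs) :
    SufficientDecrease f q lam σ x w ∧ ConvergesQuadratically x xs ∧
      IsUniqueLocalMin (objF f q lam) xs := by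
  obtain ⟨hdec, hlev⟩ := h.sufficientDecrease hμ hlam hσ hτ hf hα0 hα hrun
  have hf0 : ∀ x, 0 ≤ f x := fun x => le_trans (by positivity) (hf x)
  obtain ⟨hwx, hxw⟩ := tendsto_step_zero hσ hlam hf0 hrun hdec
  obtain ⟨ν, hν, hbound⟩ := exists_entry_lower_bound h hμ hf hq1 hlam hα0 hrun hlev
  obtain ⟨φ, hφ, hφx⟩ := hxs.tendsto_subseq
  have hφw : Tendsto (w ∘ φ) atTop (𝓝 xs) := by
    have h1 : Tendsto (fun j => w (φ j) - x (φ j)) atTop (𝓝 0) :=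
      tendsto_zero_iff_norm_tendsto_zero.2 (hwx.comp hφ.tendsto_atTop)
    have h2 := h1.add hφx
    rw [zero_add] at h2
    refine h2.congr fun j => ?_
    simp
  have hprox := mem_prox_of_tendsto h hν hbound hrun hφx hφw
  have hg := fun i hi => gradient_eq_zero_of_mem_prox hα0 hprox (i := i) hi
  have hS : ∀ i, i ∉ supp xs → xs i = 0 := fun i hi => not_mem_supp_iff.1 hi
  have hp : ContDiffAt ℝ 3 (fun z => lam * lqOn q (supp xs) z) xs :=
    contDiffAt_lqOn fun i hi => mem_supp.1 hi
  obtain ⟨K, L, ρ, hK, hL, hρ, M⟩ := h.exists_localModel (S := supp xs) hp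
    -- The value `3 / 2 * σ` lies strictly between `2 * σ`, leaving room for continuity, and `σ`,
    -- leaving room for the line search.
    (c := 3 / 2 * σ) (c' := 2 * σ) (by linarith) fun I hI hxI v hv => by
      have h1 := le_inner_of_lt_sigmaStar hσs (h.mem_genHessian hp hI hxI) hv
      have h2 := (Matrix.toEuclideanCLM (n := Fin n) (𝕜 := ℝ)).apply_symm_apply
        (A I + fderiv ℝ (gradient fun z => lam * lqOn q (supp xs) z) xs)
      rwa [h2] at h1
  have hc : 0 < 3 / 2 * σ := by linarith
  refine ⟨hdec, ?_, ⟨3 / 2 * σ / 4, by positivity,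
    M.eventually_growth h hq1 hlam hρ hc hS hg⟩,
    M.eventually_unique h hμ hmono hq0 hq1 hlam hρ hc hg⟩
  obtain ⟨C, δ, hC, hδ, hNewton⟩ :=
    M.exists_newtonPhase_bound h hK hL hρ (γ := γ) hσ (by linarith) hS hg
  obtain ⟨ε, hε, hsupp⟩ := Metric.eventually_nhds_iff_ball.1 (eventually_supp_eq hν xs)
  -- Halved because `w k` and `w (k + 1)` are within `r` of `x (k + 1)`, itself within `r` of `xs`.
  set r := min ε (min ρ δ) / 2 with hr
  have hr0 : 0 < r := by
    have : 0 < min ε (min ρ δ) := by simp [hε, hρ, hδ]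
    positivity
  have hrε : 2 * r ≤ ε := by rw [hr]; linarith [min_le_left ε (min ρ δ)]
  have hrρ : 2 * r ≤ ρ := by
    rw [hr]; linarith [min_le_right ε (min ρ δ), min_le_left ρ δ]
  have hrδ : 2 * r ≤ δ := by
    rw [hr]; linarith [min_le_right ε (min ρ δ), min_le_right ρ δ]
  refine convergesQuadratically_of_local (C := C * (4 * L / σ + 2)) (δ := r) (by positivity) hr0
    hxs ?_
  have hev1 : ∀ᶠ k in atTop, ‖w k - x k‖ < r := hwx.eventually (gt_mem_nhds hr0)
  have hev2 : ∀ᶠ k in atTop, ‖x (k + 1) - w k‖ < r := hxw.eventually (gt_mem_nhds hr0)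
  -- The estimate is proved at index `k + 1`: `x (k + 1)` inherits from `w k` the vanishing of its
  -- entries off the support, which is not known for `x 0`.
  rw [← map_add_atTop_eq_nat 1, eventually_map] at hev1 ⊢
  filter_upwards [hev1, hev2] with k h1 h2 hk
  have hw0 : ‖w k - xs‖ < 2 * r := by
    have : w k - xs = -(x (k + 1) - w k) + (x (k + 1) - xs) := by abel
    rw [this]
    refine (norm_add_le _ _).trans_lt ?_
    rw [norm_neg]
    linarith
  have hw1 : ‖w (k + 1) - xs‖ < 2 * r := by
    have := norm_sub_le_norm_sub_add_norm_sub (w (k + 1)) (x (k + 1)) xs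
    linarith
  have hs0 : supp (w k) = supp xs :=
    (hsupp _ (mem_ball_iff_norm.2 (hw0.trans_le hrε))).2 (hbound k)
  have hs1 : supp (w (k + 1)) = supp xs :=
    (hsupp _ (mem_ball_iff_norm.2 (hw1.trans_le hrε))).2 (hbound (k + 1))
  have hxS : ∀ i, i ∉ supp xs → x (k + 1) i = 0 := fun i hi =>
    (hrun k).2.apply_eq_zero (hs0 ▸ hi)
  have hwS : ∀ i, i ∉ supp xs → w (k + 1) i = 0 := fun i hi => not_mem_supp_iff.1 (hs1 ▸ hi)
  have h3 := M.norm_prox_sub_sq_le h hρ hσ hc hS hg (mem_ball_iff_norm.2 (by linarith))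
    (mem_ball_iff_norm.2 (hw1.trans_le hrρ)) hxS hwS (hdec (k + 1))
  have h4 := hNewton (w (k + 1)) (x (k + 1 + 1)) (hw1.trans_le hrδ) hs1 (hrun (k + 1)).2
  rw [mul_assoc]
  exact h4.trans (by gcongr)

end

end PSNP

theorem mainTheorem9 (n m : ℕ) (hm : 0 < m)
    (a : Fin m → PSNP.Vec n) (y : Fin m → ℝ) (hy : ∀ i, y i = 1 ∨ y i = -1)
    (μ : ℝ) (hμ : 0 < μ) (q : ℝ) (hq0 : 0 ≤ q) (hq1 : q < 1) (lam : ℝ) (hlam : 0 < lam)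
    (σ τ γ α : ℝ) (hσ : 0 < σ) (hτ : 0 < τ) (hγ0 : 0 < γ) (hγ1 : γ < 1)
    (x w : ℕ → PSNP.Vec n)
    (hα0 : 0 < α)
    (hα : α ≤ min τ (1 / (σ + PSNP.sigma0 (PSNP.fsvm a y μ) q lam τ (x 0))))
    (hrun : PSNP.IsPSNPRun (PSNP.fsvm a y μ) q lam σ γ α x w)
    (xs : PSNP.Vec n) (hxs : MapClusterPt xs atTop x)
    (hsosc : PSNP.SecondOrderSufficient (PSNP.fsvm a y μ) q lam xs)
    (hσs : (σ : EReal) < PSNP.sigmaStar (PSNP.fsvm a y μ) q lam xs) :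
    PSNP.SufficientDecrease (PSNP.fsvm a y μ) q lam σ x w ∧
    PSNP.ConvergesQuadratically x xs ∧
    PSNP.IsUniqueLocalMin (PSNP.objF (PSNP.fsvm a y μ) q lam) xs := by
  exact (PSNP.piecewiseAffineGradient_fsvm a y μ).psnp_convergence hμ
    (PSNP.mul_norm_sq_le_fsvm a y μ) (PSNP.gradient_fsvm_strongly_monotone a y μ)
    hq0 hq1 hlam hσ hτ hα0 hα hrun hxs hσs
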